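/- Let $\mathbb K$ be an algebraically closed field of characteristic zero, $T=(\mathbb K^*)^n$ a torus with character lattice $M=\mathbb Z^n$, $P\subseteq M_{\mathbb R}$ a full-dimensional normal lattice polytope, $\Lambda=P\cap M$, and $\hat X_P\subseteq\mathbb K^{\Lambda}$ the affine cone over the embedded toric variety $X_P$, i.e. the Zariski closure of $\{\sum_{\chi\in\Lambda}c\,\chi(t)e_\chi\mid (c,t)\in\hat T=\mathbb K^*\times T\}$. The torus $\hat T$ acts on $\mathbb K[\hat X_P]$ by $(\hat t\cdot g)(x)=g(\hat t^{-1}x)$. Let $S$ be the submonoid of $\mathbb Z\oplus M$ generated by the $(1,\chi)$, $\chi\in\Lambda$; for $(m,\eta)=\sum_\chi a_\chi(1,\chi)\in S$ let $f_{m,\eta}\in\mathbb K[\hat X_P]$ be the restriction of $\prod_\chi x_\chi^{a_\chi}$ (it depends only on $(m,\eta)$). Let $A$ be the poset of nonempty faces of $P$, and let $(f_\sigma)_{\sigma\in A}$ be nonzero $\hat T$-eigenfunctions in $\mathbb K[\hat X_P]$, of weights $\mu_\sigma=(-\deg f_\sigma,\tilde\mu_\sigma)$ with $\deg f_\sigma\ge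 1$, such that $-\mu_\sigma/\deg f_\sigma$ lies in the relative interior of $\{1\}\times\sigma$ for every $\sigma$ (a combinatorial Seshadri stratification). Fix a total order $>^t$ on $A$ refining inclusion, and order $\mathbb Q^A$ lexicographically, comparing the entries at the $>^t$-greatest faces first. For a maximal chain $\mathfrak C\subseteq A$ the weights $\mu_\sigma$, $\sigma\in\mathfrak C$, form a $\mathbb Q$-basis of $\mathbb Q\oplus M_{\mathbb Q}$; for a nonzero $g=\sum_\eta g_\eta$ decomposed into nonzero $\hat T$-eigenfunctions of pairwise distinct weights $\eta$ let $\nu_{\mathfrak C}(g)\in\mathbb Q^{\mathfrak C}\subseteq\mathbb Q^A$ be the minimum over these $\eta$ of the coordinate vector of $\eta$ in this basis, and put $\nu(g)=\min_{\mathfrak C}\nu_{\mathfrak C}(g)$. Let $\mathrm{gr}_\nu\mathbb K[\hat X_P]=\bigoplus_{a\in\mathbb Q^A}\mathbb K[\hat X_P]_{\ge a}/\mathbb K[\hat X_P]_{>a}$ be the associated graded algebra, and let $\bar g$ denote the class of $g\neq 0$ in degree $\nu(g)$. Let $(m_1,\chi_1),\dots,(m_p,\chi_p)\in S$ with all $m_i\ge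 1$, containing all $(1,\chi)$ with $\chi\in\Lambda$, be such that $\bar f_{m_1,\chi_1},\dots,\bar f_{m_p,\chi_p}$ generate $\mathrm{gr}_\nu\mathbb K[\hat X_P]$. Define $\theta:\mathbb K[x_1,\dots,x_p]\to\mathbb K[\hat X_P]$ by $x_i\mapsto f_{m_i,\chi_i}$ and $\bar\theta:\mathbb K[x_1,\dots,x_p]\to\mathrm{gr}_\nu\mathbb K[\hat X_P]$ by $x_i\mapsto\bar f_{m_i,\chi_i}$, and in the weighted projective space $\mathbb P(m_1,\dots,m_p)$ put $X_P=V(\ker\theta)$ and $X_0=V(\ker\bar\theta)$. For an ideal $I$ of $\mathbb K[x_1,\dots,x_p]$ let $\mathrm{in}_\nu I$ be the ideal generated by the initial forms (sums of greatest terms) of the nonzero elements of $I$ with respect to the monomial preorder in which $x^\beta\prec x^\alpha$ iff $\sum_i m_i\beta_i<\sum_i m_i\alpha_i$, or $\sum_i m_i\beta_i=\sum_i m_i\alpha_i$ and $\sum_i\beta_i\nu(f_{m_i,\chi_i})>\sum_i\alpha_i\nu(f_{m_i,\chi_i})$. For $\lambda\in\mathbb Z^p$ let $\mathrm{in}_\lambda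 I$ be the initial ideal for the weight order $x^\alpha\mapsto\lambda\cdot\alpha$. Let $s\in\mathbb G_m$ act on $\mathbb K^p$ by $s\cdot(c_1,\dots,c_p)=(s^{\lambda_1}c_1,\dots,s^{\lambda_p}c_p)$, hence on $\mathbb P(m_1,\dots,m_p)$, and on polynomials by $s\cdot x^\alpha=s^{-\lambda\cdot\alpha}x^\alpha$. Let $\lim_{s\to0}s\cdot I$ be the ideal generated by the limits $\lim_{s\to 0}s^{\deg_\lambda g}(s\cdot g)$, $0\ne g\in I$, where $\deg_\lambda g$ is the largest value of $\lambda\cdot\alpha$ on the monomials $x^\alpha$ of $g$. For $Y,Y_0\subseteq\mathbb P(m_1,\dots,m_p)$ one writes $\lim_{s\to 0}s\cdot Y=Y_0$, and calls $Y_0$ a toric degeneration of $Y$, if $Y_0=V(\mathrm{in}_\lambda I(Y))$, where $I(Y)$ is the weighted homogeneous vanishing ideal of $Y$. Theorem. One has $\mathrm{in}_\nu(\ker\theta)=\ker\bar\theta$, and there exists $\lambda\in\mathbb Z^p$ with $\mathrm{in}_\lambda(\ker\theta)=\mathrm{in}_\nu(\ker\theta)$. For every such $\lambda$, $$\lim_{s\to0}s\cdot\ker\theta=\mathrm{in}_\lambda(\ker\theta)=\mathrm{in}_\nu(\ker\theta)=\ker\bar\theta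 ,$$ and $X_0$ is a toric degeneration of $X_P$ inside $\mathbb P(m_1,\dots,m_p)$: $\lim_{s\to0}s\cdot X_P=X_0$. -/

import Mathlib

open MvPolynomial

namespace ToricDegeneration

noncomputable section

/-! ### Polytopes, lattice points, faces

The torus is `T = (Kˣ)ⁿ`, its character lattice is `M = ℤⁿ` and `M_ℝ = ℝⁿ`. -/

/-- The inclusion of the lattice `M = ℤⁿ` into `M_ℝ = ℝⁿ`. -/
def latticeToReal {n : ℕ} (χ : Fin n → ℤ) : Fin n → ℝ := fun i => (χ i : ℝ)

/-- The lattice points `Q ∩ M` of a subset `Q` of `M_ℝ`. -/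
def latticePoints {n : ℕ} (Q : Set (Fin n → ℝ)) : Set (Fin n → ℤ) :=
  {χ | latticeToReal χ ∈ Q}

/-- A lattice polytope: the convex hull of finitely many lattice points. -/
def IsLatticePolytope {n : ℕ} (P : Set (Fin n → ℝ)) : Prop :=
  ∃ s : Finset (Fin n → ℤ), P = convexHull ℝ (latticeToReal '' (s : Set (Fin n → ℤ)))

/-- The dilate `k P`. -/
def dilate {n : ℕ} (k : ℕ) (P : Set (Fin n → ℝ)) : Set (Fin n → ℝ) :=
  (fun x => (k : ℝ) • x) '' P

/-- `P` is normal: `(kP ∩ M) + (ℓP ∩ M) = (k+ℓ)P ∩ M` for all `k, ℓ ∈ ℕ`. -/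
def IsNormalPolytope {n : ℕ} (P : Set (Fin n → ℝ)) : Prop :=
  ∀ k l : ℕ, Set.image2 (fun a b => a + b) (latticePoints (dilate k P)) (latticePoints (dilate l P))
    = latticePoints (dilate (k + l) P)

/-- The poset `A` of (nonempty) faces of the polytope `P`, ordered by inclusion. The polytope is a
face of itself; a nonempty face of a polytope is the same as a nonempty exposed subset. -/
abbrev Face {n : ℕ} (P : Set (Fin n → ℝ)) : Type :=
  {F : Set (Fin n → ℝ) // IsExposed ℝ P F ∧ F.Nonempty}

/-- The lattice points of `P`, as an index type (`Λ = P ∩ M`). -/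
abbrev Lam {n : ℕ} (P : Set (Fin n → ℝ)) : Type := {χ : Fin n → ℤ // χ ∈ latticePoints P}

/-- The character lattice `M̂ = ℤ ⊕ M` of the torus `T̂ = Kˣ × T`. -/
abbrev HatM (n : ℕ) : Type := ℤ × (Fin n → ℤ)

/-- The inclusion of `M̂` into `M̂_ℚ = ℚ ⊕ M_ℚ`. -/
def ratWeight {n : ℕ} (w : HatM n) : ℚ × (Fin n → ℚ) := ((w.1 : ℚ), fun i => (w.2 i : ℚ))

/-- The weight monoid: the submonoid of `ℤ ⊕ M` generated by the `(1, χ)`, `χ ∈ Λ`. -/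
def weightMonoid {n : ℕ} (P : Set (Fin n → ℝ)) : AddSubmonoid (HatM n) :=
  AddSubmonoid.closure {w | w.1 = 1 ∧ w.2 ∈ latticePoints P}

/-! ### The affine cone over the embedded toric variety and its coordinate ring -/

/-- The value `χ(t)` of the character `χ` at the point `t` of the torus `T = (Kˣ)ⁿ`. -/
def torusChar {K : Type*} [Field K] {n : ℕ} (χ : Fin n → ℤ) (t : Fin n → Kˣ) : Kˣ :=
  ∏ i, t i ^ χ i

/-- The value of the character `w = (a, χ)` at the point `(c, t)` of `T̂ = Kˣ × T`. -/
def hatChar {K : Type*} [Field K] {n : ℕ} (w : HatM n) (c : Kˣ) (t : Fin n → Kˣ) : Kˣ :=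
  c ^ w.1 * torusChar w.2 t

/-- The map `T̂ → V = K^Λ`, `(c, t) ↦ ∑_χ c χ(t) e_χ`. -/
def hatIota (K : Type*) [Field K] {n : ℕ} (P : Set (Fin n → ℝ)) (c : Kˣ) (t : Fin n → Kˣ) :
    Lam P → K :=
  fun χ => ((c * torusChar χ.1 t : Kˣ) : K)

/-- The affine cone `X̂_P ⊆ V`: the Zariski closure of the image of `T̂`. -/
def affineCone (K : Type*) [Field K] {n : ℕ} (P : Set (Fin n → ℝ)) : Set (Lam P → K) :=
  zeroLocus K (vanishingIdeal K (Set.range fun s : Kˣ × (Fin n → Kˣ) => hatIota K P s.1 s.2))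

/-- The vanishing ideal of the affine cone. -/
def coneIdeal (K : Type*) [Field K] {n : ℕ} (P : Set (Fin n → ℝ)) :
    Ideal (MvPolynomial (Lam P) K) :=
  vanishingIdeal K (affineCone K P)

/-- The coordinate ring `K[X̂_P]` of the affine cone, which is the homogeneous coordinate ring of
the embedded toric variety `X_P ⊆ ℙ(V)`. -/
abbrev CoordRing (K : Type*) [Field K] {n : ℕ} (P : Set (Fin n → ℝ)) : Type _ :=
  MvPolynomial (Lam P) K ⧸ coneIdeal K P

theorem mem_coneIdeal_iff {K : Type*} [Field K] {n : ℕ} {P : Set (Fin n → ℝ)}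
    {f : MvPolynomial (Lam P) K} :
    f ∈ coneIdeal K P ↔ ∀ (c : Kˣ) (t : Fin n → Kˣ), aeval (hatIota K P c t) f = 0 := by
  constructor
  · intro hf c t
    exact hf _ (zeroLocus_vanishingIdeal_le _ ⟨(c, t), rfl⟩)
  · intro hf
    refine le_vanishingIdeal_zeroLocus _ ?_
    rintro _ ⟨⟨c, t⟩, rfl⟩
    exact hf c t

/-- The action of `(c, t) ∈ T̂` on `K[V]`, `((c, t) · g)(x) = g((c, t)⁻¹ x)`. -/
def polyAct (K : Type*) [Field K] {n : ℕ} (P : Set (Fin n → ℝ)) (c : Kˣ) (t : Fin n → Kˣ) :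
    MvPolynomial (Lam P) K →ₐ[K] MvPolynomial (Lam P) K :=
  aeval fun χ => C (((c * torusChar χ.1 t)⁻¹ : Kˣ) : K) * X χ

theorem coneIdeal_le_comap (K : Type*) [Field K] {n : ℕ} (P : Set (Fin n → ℝ)) (c : Kˣ)
    (t : Fin n → Kˣ) : coneIdeal K P ≤ (coneIdeal K P).comap (polyAct K P c t) := by
  intro f hf
  rw [Ideal.mem_comap, mem_coneIdeal_iff]
  intro c' t'
  have h := mem_coneIdeal_iff.1 hf (c⁻¹ * c') (t⁻¹ * t')
  have e : (aeval (hatIota K P c' t')).comp (polyAct K P c t)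
      = aeval (hatIota K P (c⁻¹ * c') (t⁻¹ * t')) := by
    ext χ
    have h2 : (c * torusChar χ.1 t)⁻¹ * (c' * torusChar χ.1 t')
        = c⁻¹ * c' * torusChar χ.1 (t⁻¹ * t') := by
      simp only [torusChar, Pi.mul_apply, Pi.inv_apply, mul_zpow, inv_zpow, Finset.prod_mul_distrib,
        Finset.prod_inv_distrib, mul_inv]
      exact mul_mul_mul_comm _ _ _ _
    have h3 := congrArg (fun u : Kˣ => (u : K)) h2
    simpa [polyAct, hatIota] using h3
  rw [← e] at h
  exact h

/-- The induced action of `(c, t) ∈ T̂` on the coordinate ring `K[X̂_P]`. -/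
def hatAct (K : Type*) [Field K] {n : ℕ} (P : Set (Fin n → ℝ)) (c : Kˣ) (t : Fin n → Kˣ) :
    CoordRing K P →ₐ[K] CoordRing K P :=
  Ideal.quotientMapₐ (coneIdeal K P) (polyAct K P c t) (coneIdeal_le_comap K P c t)

/-- `g` is zero or a `T̂`-eigenfunction of weight `w`. -/
def IsEigen {K : Type*} [Field K] {n : ℕ} {P : Set (Fin n → ℝ)} (w : HatM n)
    (g : CoordRing K P) : Prop :=
  ∀ (c : Kˣ) (t : Fin n → Kˣ), hatAct K P c t g = algebraMap K (CoordRing K P) (hatChar w c t : Kˣ) * g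

/-- The set of weights `η` for which the component `g_η` in the decomposition of `g` into
`T̂`-eigenfunctions of pairwise distinct weights is nonzero. -/
def weightsOf {K : Type*} [Field K] {n : ℕ} {P : Set (Fin n → ℝ)} (g : CoordRing K P) :
    Set (HatM n) :=
  {w | ∃ d : HatM n →₀ CoordRing K P,
    (∀ η, IsEigen η (d η)) ∧ (d.sum fun _ x => x) = g ∧ d w ≠ 0}

/-- The basis function `f_{m,η}` for `w = (m, η)` in the weight monoid: the restriction to `X̂_P` of
a monomial `∏ x_χ ^ a_χ` with `∑ a_χ (1, χ) = (m, η)`. The restriction does not depend on the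
choice of the decomposition. -/
def basisFn (K : Type*) [Field K] {n : ℕ} (P : Set (Fin n → ℝ)) (w : HatM n) : CoordRing K P :=
  open Classical in
  if h : ∃ a : Lam P →₀ ℕ, Finsupp.weight (fun χ : Lam P => ((1 : ℤ), χ.1)) a = w then
    Ideal.Quotient.mk (coneIdeal K P) (monomial h.choose 1)
  else 0

/-! ### Combinatorial Seshadri stratifications and the quasi-valuation -/

/-- A combinatorial Seshadri stratification `(X_σ, f_σ)_{σ ∈ A}`. The varieties `X_σ` are the
`T`-orbit closures, so the data are the `T̂`-eigenfunctions `f_σ`, with their weights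
`μ_σ = (-deg f_σ, μ̃_σ)`; the degrees are positive, and `-μ_σ / deg f_σ` lies in the relative
interior of `σ` (its first coordinate is `1`, and `P` is identified with `{1} × P`). -/
structure CombSeshadriStratification (K : Type*) [Field K] {n : ℕ} (P : Set (Fin n → ℝ)) where
  f : Face P → CoordRing K P
  μ : Face P → HatM n
  f_ne_zero : ∀ σ, f σ ≠ 0
  f_eigen : ∀ σ, IsEigen (μ σ) (f σ)
  one_le_degree : ∀ σ, 1 ≤ -(μ σ).1
  mem_relint : ∀ σ : Face P,
    (fun i => (-((μ σ).2 i) : ℝ) / (-((μ σ).1) : ℝ)) ∈ intrinsicInterior ℝ σ.1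

/-- The strict lexicographic order on `ℚ^A` induced by a strict total order `r` on `A`
(`r σ τ` is read `σ <ᵗ τ`); the entries at the greatest elements of `A` are compared first. -/
def lexLT {n : ℕ} {P : Set (Fin n → ℝ)} (r : Face P → Face P → Prop) (a b : Face P →₀ ℚ) : Prop :=
  ∃ σ, (∀ τ, r σ τ → a τ = b τ) ∧ a σ < b σ

/-- The minimum of a (nonempty, finite) subset of `ℚ^A` for the lexicographic order. -/
def lexMin {n : ℕ} {P : Set (Fin n → ℝ)} (r : Face P → Face P → Prop)
    (s : Set (Face P →₀ ℚ)) : Face P →₀ ℚ :=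
  Classical.epsilon fun a => a ∈ s ∧ ∀ b ∈ s, a = b ∨ lexLT r a b

/-- The value of `ν_ℭ` on a `T̂`-eigenfunction of weight `w`: the coordinates of `w` with respect to
the `ℚ`-basis `(μ_σ)_{σ ∈ ℭ}` of `M̂_ℚ`, for a maximal chain `ℭ` in `A`, with `ℚ^ℭ ⊆ ℚ^A`. -/
def chainCoord {K : Type*} [Field K] {n : ℕ} {P : Set (Fin n → ℝ)}
    (S : CombSeshadriStratification K P) (ch : Flag (Face P)) (w : HatM n) : Face P →₀ ℚ :=
  Classical.epsilon fun a => (∀ σ ∈ a.support, σ ∈ ch) ∧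
    (a.sum fun σ q => q • ratWeight (S.μ σ)) = ratWeight w

/-- The valuation `ν_ℭ` (meaningful on nonzero functions), for a maximal chain `ℭ` in `A`. -/
def chainVal {K : Type*} [Field K] {n : ℕ} {P : Set (Fin n → ℝ)}
    (S : CombSeshadriStratification K P) (r : Face P → Face P → Prop) (ch : Flag (Face P))
    (g : CoordRing K P) : Face P →₀ ℚ :=
  lexMin r (chainCoord S ch '' weightsOf g)

/-- The quasi-valuation `ν = min_ℭ ν_ℭ` (meaningful on nonzero functions). -/
def quasiVal {K : Type*} [Field K] {n : ℕ} {P : Set (Fin n → ℝ)}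
    (S : CombSeshadriStratification K P) (r : Face P → Face P → Prop)
    (g : CoordRing K P) : Face P →₀ ℚ :=
  lexMin r (Set.range fun ch : Flag (Face P) => chainVal S r ch g)

/-! ### The associated graded algebra

`gr_ν K[X̂_P] = ⨁_a K[X̂_P]_{≥ a} / K[X̂_P]_{> a}` is realised as the quotient of the algebra
`⨁_a K[X̂_P]_{≥ a} z^a`, a subalgebra of the group algebra of `ℚ^A` over `K[X̂_P]`, by the ideal
`⨁_a K[X̂_P]_{> a} z^a`. -/

/-- The group algebra of `ℚ^A` over `K[X̂_P]`. -/
def GroupAlg (K : Type*) [Field K] {n : ℕ} (P : Set (Fin n → ℝ)) : Type _ :=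
  AddMonoidAlgebra (CoordRing K P) (Face P →₀ ℚ)

instance (K : Type*) [Field K] {n : ℕ} (P : Set (Fin n → ℝ)) : CommRing (GroupAlg K P) :=
  inferInstanceAs (CommRing (AddMonoidAlgebra (CoordRing K P) (Face P →₀ ℚ)))

instance (K : Type*) [Field K] {n : ℕ} (P : Set (Fin n → ℝ)) : Algebra K (GroupAlg K P) :=
  inferInstanceAs (Algebra K (AddMonoidAlgebra (CoordRing K P) (Face P →₀ ℚ)))

/-- The element `g z^a` of the group algebra. -/
def GroupAlg.term {K : Type*} [Field K] {n : ℕ} {P : Set (Fin n → ℝ)} (a : Face P →₀ ℚ)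
    (g : CoordRing K P) : GroupAlg K P :=
  (AddMonoidAlgebra.single a g : AddMonoidAlgebra (CoordRing K P) (Face P →₀ ℚ))

/-- The algebra `⨁_a K[X̂_P]_{≥ a} z^a`. -/
def reesAlgebra {K : Type*} [Field K] {n : ℕ} {P : Set (Fin n → ℝ)}
    (S : CombSeshadriStratification K P) (r : Face P → Face P → Prop) :
    Subalgebra K (GroupAlg K P) :=
  Algebra.adjoin K {F | ∃ (a : Face P →₀ ℚ) (g : CoordRing K P), g ≠ 0 ∧
    (a = quasiVal S r g ∨ lexLT r a (quasiVal S r g)) ∧ F = GroupAlg.term a g}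

/-- The ideal `⨁_a K[X̂_P]_{> a} z^a`. -/
def reesIdeal {K : Type*} [Field K] {n : ℕ} {P : Set (Fin n → ℝ)}
    (S : CombSeshadriStratification K P) (r : Face P → Face P → Prop) :
    Ideal (reesAlgebra S r) :=
  Ideal.span {F | ∃ (a : Face P →₀ ℚ) (g : CoordRing K P), g ≠ 0 ∧
    lexLT r a (quasiVal S r g) ∧
    (F : GroupAlg K P) = GroupAlg.term a g}

/-- The associated graded algebra `gr_ν K[X̂_P]`. -/
abbrev AssocGraded {K : Type*} [Field K] {n : ℕ} {P : Set (Fin n → ℝ)}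
    (S : CombSeshadriStratification K P) (r : Face P → Face P → Prop) : Type _ :=
  reesAlgebra S r ⧸ reesIdeal S r

theorem single_mem_reesAlgebra {K : Type*} [Field K] {n : ℕ} {P : Set (Fin n → ℝ)}
    (S : CombSeshadriStratification K P) (r : Face P → Face P → Prop) (g : CoordRing K P) :
    GroupAlg.term (quasiVal S r g) g ∈ reesAlgebra S r := by
  by_cases hg : g = 0
  · have h0 : GroupAlg.term (quasiVal S r g) g = 0 := by
      rw [hg]; exact AddMonoidAlgebra.single_zero _
    rw [h0]
    exact Subalgebra.zero_mem _
  · exact Algebra.subset_adjoin ⟨_, g, hg, Or.inl rfl, rfl⟩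

/-- The class `ḡ ∈ K[X̂_P]_{≥ ν(g)} / K[X̂_P]_{> ν(g)} ⊆ gr_ν K[X̂_P]` of a nonzero `g`. -/
def grClass {K : Type*} [Field K] {n : ℕ} {P : Set (Fin n → ℝ)}
    (S : CombSeshadriStratification K P) (r : Face P → Face P → Prop) (g : CoordRing K P) :
    AssocGraded S r :=
  Ideal.Quotient.mk (reesIdeal S r)
    ⟨GroupAlg.term (quasiVal S r g) g, single_mem_reesAlgebra S r g⟩

/-- The morphism `θ : K[x_1, …, x_p] → K[X̂_P]`, `x_i ↦ f_{m_i, χ_i}`, with `w i = (m_i, χ_i)`. -/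
def theta (K : Type*) [Field K] {n : ℕ} (P : Set (Fin n → ℝ)) {p : ℕ} (w : Fin p → HatM n) :
    MvPolynomial (Fin p) K →ₐ[K] CoordRing K P :=
  aeval fun i => basisFn K P (w i)

/-- The morphism `θ̄ : K[x_1, …, x_p] → gr_ν K[X̂_P]`, `x_i ↦ f̄_{m_i, χ_i}`. -/
def thetaBar {K : Type*} [Field K] {n : ℕ} {P : Set (Fin n → ℝ)}
    (S : CombSeshadriStratification K P) (r : Face P → Face P → Prop) {p : ℕ}
    (w : Fin p → HatM n) : MvPolynomial (Fin p) K →ₐ[K] AssocGraded S r :=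
  aeval fun i => grClass S r (basisFn K P (w i))

/-! ### Initial ideals and limits -/

/-- The sum of the greatest terms of `g`, for a preorder on monomials with strict part `lt`. -/
def initialForm {K : Type*} [Field K] {p : ℕ} (lt : (Fin p →₀ ℕ) → (Fin p →₀ ℕ) → Prop)
    (g : MvPolynomial (Fin p) K) : MvPolynomial (Fin p) K :=
  open Classical in
  ∑ α ∈ g.support with ∀ β ∈ g.support, ¬ lt α β, monomial α (coeff α g)

/-- The ideal generated by the initial terms of the nonzero elements of `I`. -/
def initialIdeal {K : Type*} [Field K] {p : ℕ} (lt : (Fin p →₀ ℕ) → (Fin p →₀ ℕ) → Prop)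
    (I : Ideal (MvPolynomial (Fin p) K)) : Ideal (MvPolynomial (Fin p) K) :=
  Ideal.span {h | ∃ g ∈ I, g ≠ 0 ∧ h = initialForm lt g}

/-- The strict part `≺_A` of the monomial preorder given by the additive degree
`deg_A x_i = (m_i, ν(f_{m_i, χ_i}))`, where `(m', a') ≺ (m, a)` if `m' < m`, or `m' = m` and
`a' >ᵗ a`. -/
def nuLT {K : Type*} [Field K] {n : ℕ} {P : Set (Fin n → ℝ)}
    (S : CombSeshadriStratification K P) (r : Face P → Face P → Prop) {p : ℕ}
    (w : Fin p → HatM n) (α β : Fin p →₀ ℕ) : Prop :=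
  Finsupp.weight (fun i => (w i).1) α < Finsupp.weight (fun i => (w i).1) β ∨
    Finsupp.weight (fun i => (w i).1) α = Finsupp.weight (fun i => (w i).1) β ∧
      lexLT r (Finsupp.weight (fun i => quasiVal S r (basisFn K P (w i))) β)
        (Finsupp.weight (fun i => quasiVal S r (basisFn K P (w i))) α)

/-- The initial ideal `in_ν I`. -/
def inNu {K : Type*} [Field K] {n : ℕ} {P : Set (Fin n → ℝ)}
    (S : CombSeshadriStratification K P) (r : Face P → Face P → Prop) {p : ℕ}
    (w : Fin p → HatM n) (I : Ideal (MvPolynomial (Fin p) K)) :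
    Ideal (MvPolynomial (Fin p) K) :=
  initialIdeal (nuLT S r w) I

/-- The initial ideal `in_λ I` for the integral weight order given by `λ ∈ ℤ^p`. -/
def inWeight {K : Type*} [Field K] {p : ℕ} (lam : Fin p → ℤ)
    (I : Ideal (MvPolynomial (Fin p) K)) : Ideal (MvPolynomial (Fin p) K) :=
  initialIdeal (fun α β => Finsupp.weight lam α < Finsupp.weight lam β) I

/-- The action of `s ∈ 𝔾_m` on `K[x_1, …, x_p]` induced by the action
`s · (c_1, …, c_p) = (s^{λ_1} c_1, …, s^{λ_p} c_p)` on `K^p`; `s · x^α = s^{-λ·α} x^α`. -/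
def gmAct {K : Type*} [Field K] {p : ℕ} (lam : Fin p → ℤ) (s : Kˣ) :
    MvPolynomial (Fin p) K →ₐ[K] MvPolynomial (Fin p) K :=
  aeval fun i => C ((s ^ (-lam i) : Kˣ) : K) * X i

/-- `lim_{s → 0} φ(s) = h`: the family `φ` extends to a polynomial family over the affine line, with
value `h` at `0`. -/
def IsLimitAtZero {K : Type*} [Field K] {p : ℕ} (φ : Kˣ → MvPolynomial (Fin p) K)
    (h : MvPolynomial (Fin p) K) : Prop :=
  ∃ F : Polynomial (MvPolynomial (Fin p) K),
    (∀ s : Kˣ, F.eval (C (s : K)) = φ s) ∧ F.eval 0 = h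

/-- The ideal `lim_{s → 0} s · I`, generated by the limits of the rescaled functions
`s^{deg_λ g} (s · g)`, `0 ≠ g ∈ I`, where `deg_λ g` is the maximum of the `λ · α` over the
monomials `x^α` of `g`. -/
def limitIdeal {K : Type*} [Field K] {p : ℕ} (lam : Fin p → ℤ)
    (I : Ideal (MvPolynomial (Fin p) K)) : Ideal (MvPolynomial (Fin p) K) :=
  Ideal.span {h | ∃ g ∈ I, g ≠ 0 ∧ ∃ d : ℤ,
    IsGreatest ((fun α => Finsupp.weight lam α) '' (g.support : Set (Fin p →₀ ℕ))) d ∧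
    IsLimitAtZero (fun s => ((s ^ d : Kˣ) : K) • gmAct lam s g) h}

/-! ### Weighted projective spaces -/

/-- The orbit relation of the grading group `Kˣ` acting on `K^p ∖ {0}` by
`ξ · (a_1, …, a_p) = (ξ^{m_1} a_1, …, ξ^{m_p} a_p)`. -/
def weightedSetoid (K : Type*) [Field K] {p : ℕ} (m : Fin p → ℕ) :
    Setoid {v : Fin p → K // v ≠ 0} where
  r v v' := ∃ ξ : Kˣ, ∀ i, v'.1 i = (ξ : K) ^ m i * v.1 i
  iseqv :=
    { refl := fun _ => ⟨1, fun i => by simp⟩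
      symm := by
        rintro v v' ⟨ξ, h⟩
        refine ⟨ξ⁻¹, fun i => ?_⟩
        rw [h i, ← mul_assoc, ← mul_pow]
        simp
      trans := by
        rintro v v' v'' ⟨ξ, h⟩ ⟨ζ, h'⟩
        refine ⟨ζ * ξ, fun i => ?_⟩
        rw [h' i, h i, Units.val_mul, mul_pow, mul_assoc] }

/-- The weighted projective space `ℙ(m_1, …, m_p) = (K^p ∖ {0}) / Kˣ`. -/
def WeightedProj (K : Type*) [Field K] {p : ℕ} (m : Fin p → ℕ) : Type _ :=
  Quotient (weightedSetoid K m)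

/-- The point `[v]` of the weighted projective space. -/
def WeightedProj.mk {K : Type*} [Field K] {p : ℕ} (m : Fin p → ℕ) (v : {v : Fin p → K // v ≠ 0}) :
    WeightedProj K m :=
  Quotient.mk (weightedSetoid K m) v

/-- The polynomial `f` vanishes at the point `x` (all representatives). -/
def VanishesAt {K : Type*} [Field K] {p : ℕ} {m : Fin p → ℕ} (f : MvPolynomial (Fin p) K)
    (x : WeightedProj K m) : Prop :=
  ∀ v : {v : Fin p → K // v ≠ 0}, WeightedProj.mk m v = x → eval v.1 f = 0

/-- The weighted algebraic set `V(I) ⊆ ℙ(m_1, …, m_p)`: the common zeros of the weighted homogeneous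
elements of `I`. -/
def weightedV {K : Type*} [Field K] {p : ℕ} (m : Fin p → ℕ) (I : Ideal (MvPolynomial (Fin p) K)) :
    Set (WeightedProj K m) :=
  {x | ∀ f ∈ I, ∀ d : ℕ, IsWeightedHomogeneous m f d → VanishesAt f x}

/-- The weighted homogeneous vanishing ideal `I(Y)` of `Y ⊆ ℙ(m_1, …, m_p)`. -/
def weightedI {K : Type*} [Field K] {p : ℕ} {m : Fin p → ℕ} (Y : Set (WeightedProj K m)) :
    Ideal (MvPolynomial (Fin p) K) :=
  Ideal.span {f | (∃ d : ℕ, IsWeightedHomogeneous m f d) ∧ ∀ x ∈ Y, VanishesAt f x}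

/-- `lim_{s → 0} s · Y = Y₀` for the `𝔾_m`-action on `ℙ(m_1, …, m_p)` given by `λ ∈ ℤ^p`, that is,
`Y₀` is a toric degeneration of `Y` inside `ℙ(m_1, …, m_p)`: `Y₀ = V(in_λ I(Y))`. -/
def IsToricDegeneration {K : Type*} [Field K] {p : ℕ} {m : Fin p → ℕ} (lam : Fin p → ℤ)
    (Y Y₀ : Set (WeightedProj K m)) : Prop :=
  Y₀ = weightedV m (inWeight lam (weightedI Y))

end

end ToricDegeneration

open ToricDegeneration

namespace ToricDegeneration

noncomputable section

/-! ### The lexicographic order -/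

/-! Distinct characters of T̂ are linearly independent functions, so x_χ ↦ z^{(1,χ)} embeds K[X̂_P]
into the group algebra of ℤ ⊕ M. The f_u, u ∈ S, form a basis, and f_u f_v = f_{u+v}. Since f_u has
weight -u, ν(f_u) is the least coordinate vector of -u over the bases given by the maximal chains
(`monoVal`), and ν(g) is the least ν(f_u) over the f_u occurring in g (`quasiVal_spec`). Coordinates
are additive in u, so their minimum is superadditive: ν(f_u) + ν(f_v) ≤ ν(f_{u+v}). In gr_ν the
product of the classes of f_u and f_v is the class of f_{u+v} if equality holds, and 0 otherwise.

The rest is about exponents. Put W(α) = ∑ α_i (m_i, χ_i) and call α exact if ∑ α_i ν(f_i) =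
ν(f_{W(α)}), where f_i = f_{m_i,χ_i} (`exactExps`). A polynomial lies in ker θ iff its coefficients
sum to zero on every fibre of W, and in ker θ̄ iff they sum to zero on the exact part of every fibre
(`mem_ker_theta_iff`, `mem_ker_thetaBar_iff`). Because the classes generate gr_ν, every fibre has an
exact exponent. By superadditivity the exact exponents share the largest value in their fibre, hence
are its lowest part for the preorder. Any order with this property turns ker θ into ker θ̄
(`initialIdeal_eq`): for β exact, x^α - x^β has initial form x^α if α is not exact, and is its own
initial form if α is exact.

So λ only has to separate exact from inexact exponents inside fibres. By Dickson's lemma finitely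
many comparisons suffice (`exists_linear_separating`), and finitely many lexicographic inequalities
are realised by one linear functional with rapidly growing coefficients. Finally, s^{deg_λ g}(s·g)
tends to the initial form of g, and I(X_P) = ker θ because T̂ maps into X_P and ker θ is spanned by
homogeneous binomials. -/

theorem exists_forall_eq_or_rel {α : Type*} (r : α → α → Prop) [IsStrictTotalOrder α r]
    {s : Set α} (hs : s.Finite) (hne : s.Nonempty) : ∃ m ∈ s, ∀ x ∈ s, m = x ∨ r m x := by
  classical
  let := linearOrderOfSTO r
  obtain ⟨m, hm, h⟩ := hs.exists_minimal hne
  refine ⟨m, hm, fun x hx => ?_⟩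
  rcases lt_trichotomy m x with h1 | h1 | h1
  · exact Or.inr h1
  · exact Or.inl h1
  · exact absurd (h hx h1.le) (not_le.2 h1)

/-- Induction on the greatest coordinate a: a functional L that works for the vectors vanishing at a
is corrected to M · (coordinate a) + L. The finiteness of V allows one M large enough for all
vectors with positive entry at a. -/
theorem exists_linear_pos_of_leading_pos {α : Type*} [LinearOrder α] (T : Finset α) :
    ∀ V : Set (α →₀ ℚ), V.Finite →
      (∀ v ∈ V, v.support ⊆ T ∧ ∃ σ, (∀ τ, σ < τ → v τ = 0) ∧ 0 < v σ) →
      ∃ L : (α →₀ ℚ) →ₗ[ℚ] ℚ, ∀ v ∈ V, 0 < L v := by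
  classical
  induction T using Finset.induction_on_max with
  | empty =>
    intro V _ h
    refine ⟨0, fun v hv => ?_⟩
    obtain ⟨h1, σ, -, h2⟩ := h v hv
    have : v = 0 := by simpa using h1
    simp [this] at h2
  | insert a T ha ih =>
    intro V hV h
    obtain ⟨L, hL⟩ := ih {v | v ∈ V ∧ v a = 0} (hV.subset fun v hv => hv.1) (by
      rintro v ⟨hv, h0⟩
      obtain ⟨h1, h2⟩ := h v hv
      refine ⟨fun x hx => ?_, h2⟩
      rcases Finset.mem_insert.1 (h1 hx) with rfl | h3
      · exact absurd h0 (Finsupp.mem_support_iff.1 hx)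
      · exact h3)
    have hlarge : ∀ v ∈ V, ∀ᶠ M : ℚ in Filter.atTop, 0 < M * v a + L v := by
      intro v hv
      by_cases h0 : v a = 0
      · exact Filter.Eventually.of_forall fun M => by simpa [h0] using hL v ⟨hv, h0⟩
      · obtain ⟨h1, σ, h2, h3⟩ := h v hv
        have hσ : σ = a := by
          rcases Finset.mem_insert.1 (h1 (Finsupp.mem_support_iff.2 h3.ne')) with h4 | h4
          · exact h4
          · exact absurd (h2 a (ha σ h4)) h0
        subst hσ
        exact (Filter.tendsto_atTop_add_const_right _ _
          (Filter.tendsto_id.atTop_mul_const h3)).eventually_gt_atTop 0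
    obtain ⟨M, hM⟩ := ((Filter.eventually_all_finite hV).2 hlarge).exists
    exact ⟨M • Finsupp.lapply a + L, fun v hv => by simpa using hM v hv⟩

theorem exists_nat_mul_eq_intCast {ι : Type*} [Fintype ι] (q : ι → ℚ) :
    ∃ D : ℕ, 0 < D ∧ ∃ z : ι → ℤ, ∀ i, (z i : ℚ) = D * q i := by
  classical
  refine ⟨∏ i, (q i).den, Finset.prod_pos fun i _ => (q i).pos,
    fun i => (∏ j ∈ Finset.univ.erase i, ((q j).den : ℤ)) * (q i).num, fun i => ?_⟩
  rw [← Finset.mul_prod_erase Finset.univ _ (Finset.mem_univ i)]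
  push_cast
  rw [mul_comm ((q i).den : ℚ), mul_assoc, mul_comm ((q i).den : ℚ), Rat.mul_den_eq_num]

section LexOrder

variable {n : ℕ} {P : Set (Fin n → ℝ)} {r : Face P → Face P → Prop}

theorem lexLT_add_left_iff {a b : Face P →₀ ℚ} (c : Face P →₀ ℚ) :
    lexLT r (c + a) (c + b) ↔ lexLT r a b := by
  simp [lexLT]

theorem lexLT_add_right_iff {a b : Face P →₀ ℚ} (c : Face P →₀ ℚ) :
    lexLT r (a + c) (b + c) ↔ lexLT r a b := by
  simp [lexLT]

variable [IsStrictTotalOrder (Face P) r]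

instance lexLT_isStrictTotalOrder : IsStrictTotalOrder (Face P →₀ ℚ) (lexLT r) where
  irrefl := by
    rintro a ⟨σ, -, h⟩
    exact lt_irrefl _ h
  trans := by
    rintro a b c ⟨σ, h1, h2⟩ ⟨τ, h3, h4⟩
    rcases trichotomous_of r σ τ with h | rfl | h
    · exact ⟨τ, fun ρ hρ => (h1 ρ (_root_.trans h hρ)).trans (h3 ρ hρ), (h1 τ h).trans_lt h4⟩
    · exact ⟨σ, fun ρ hρ => (h1 ρ hρ).trans (h3 ρ hρ), h2.trans h4⟩
    · exact ⟨σ, fun ρ hρ => (h1 ρ hρ).trans (h3 ρ (_root_.trans h hρ)), h2.trans_eq (h3 σ h)⟩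
  trichotomous := by
    intro a b hab hba
    by_contra hne
    have hs : ((a - b).support : Set (Face P)).Nonempty := by
      rw [Finset.coe_nonempty, Finsupp.support_nonempty_iff]
      exact sub_ne_zero.2 hne
    -- The least element for the swapped relation is the `r`-greatest face where a and b differ; it
    -- exists because supports are finite.
    obtain ⟨σ, hσ, h⟩ := exists_forall_eq_or_rel (Function.swap r) (Finset.finite_toSet _) hs
    have key : ∀ τ, r σ τ → a τ = b τ := by
      intro τ hτ
      by_contra hτ'
      rcases h τ (by simpa [sub_eq_zero] using hτ') with h1 | h1
      · exact irrefl_of r _ (h1 ▸ hτ)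
      · exact asymm_of r hτ h1
    have hσ' : a σ ≠ b σ := by simpa [sub_eq_zero] using hσ
    rcases lt_or_gt_of_ne hσ' with h1 | h1
    · exact hab ⟨σ, key, h1⟩
    · exact hba ⟨σ, fun τ hτ => (key τ hτ).symm, h1⟩

/-- The reflexive closure of `lexLT`. -/
def lexLE (r : Face P → Face P → Prop) (a b : Face P →₀ ℚ) : Prop := a = b ∨ lexLT r a b

theorem lexLE.trans {a b c : Face P →₀ ℚ} (h : lexLE r a b) (h' : lexLE r b c) : lexLE r a c := by
  rcases h with rfl | h
  · exact h'
  · rcases h' with rfl | h'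
    · exact Or.inr h
    · exact Or.inr (_root_.trans h h')

theorem lexLT_of_lexLT_of_lexLE {a b c : Face P →₀ ℚ} (h : lexLT r a b) (h' : lexLE r b c) :
    lexLT r a c := by
  rcases h' with rfl | h'
  · exact h
  · exact _root_.trans h h'

theorem lexLT_of_lexLE_of_lexLT {a b c : Face P →₀ ℚ} (h : lexLE r a b) (h' : lexLT r b c) :
    lexLT r a c := by
  rcases h with rfl | h
  · exact h'
  · exact _root_.trans h h'

theorem not_lexLT_iff {a b : Face P →₀ ℚ} : ¬ lexLT r a b ↔ lexLE r b a := by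
  constructor
  · intro h
    rcases trichotomous_of (lexLT r) a b with h1 | h1 | h1
    · exact absurd h1 h
    · exact Or.inl h1.symm
    · exact Or.inr h1
  · rintro (rfl | h) h'
    · exact irrefl_of _ _ h'
    · exact asymm_of _ h h'

theorem lexLE.antisymm {a b : Face P →₀ ℚ} (h : lexLE r a b) (h' : lexLE r b a) : a = b := by
  rcases h with h | h
  · exact h
  · exact absurd h (not_lexLT_iff.2 h')

theorem lexLE.add {a b c d : Face P →₀ ℚ} (h : lexLE r a b) (h' : lexLE r c d) :
    lexLE r (a + c) (b + d) := by
  refine lexLE.trans (b := b + c) ?_ ?_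
  · rcases h with rfl | h
    · exact Or.inl rfl
    · exact Or.inr ((lexLT_add_right_iff c).2 h)
  · rcases h' with rfl | h'
    · exact Or.inl rfl
    · exact Or.inr ((lexLT_add_left_iff b).2 h')

/-- Finiteness and nonemptiness are what make the choice in `lexMin` an actual minimum. -/
theorem lexMin_spec {s : Set (Face P →₀ ℚ)} (hs : s.Finite) (hne : s.Nonempty) :
    lexMin r s ∈ s ∧ ∀ b ∈ s, lexLE r (lexMin r s) b :=
  Classical.epsilon_spec (p := fun a => a ∈ s ∧ ∀ b ∈ s, a = b ∨ lexLT r a b)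
    (exists_forall_eq_or_rel (lexLT r) hs hne)

theorem exists_linear_pos_of_lexLT {V : Set (Face P →₀ ℚ)} (hV : V.Finite)
    (h : ∀ v ∈ V, lexLT r 0 v) : ∃ L : (Face P →₀ ℚ) →ₗ[ℚ] ℚ, ∀ v ∈ V, 0 < L v := by
  classical
  refine @exists_linear_pos_of_leading_pos _ (linearOrderOfSTO r)
    (hV.toFinset.biUnion fun v => v.support) V hV fun v hv => ⟨?_, ?_⟩
  · exact Finset.subset_biUnion_of_mem (fun v : Face P →₀ ℚ => v.support) (hV.mem_toFinset.2 hv)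
  · obtain ⟨σ, h1, h2⟩ := h v hv
    exact ⟨σ, fun τ hτ => (h1 τ hτ).symm, h2⟩

end LexOrder

/-! ### Faces and maximal chains of faces of a lattice polytope -/

section Polytope

variable {n : ℕ} {P : Set (Fin n → ℝ)}

theorem Face.exists_support (σ : Face P) : ∃ (l : StrongDual ℝ (Fin n → ℝ)) (c : ℝ),
    (∀ y ∈ P, l y + c ≤ 0) ∧ ∀ y ∈ P, (y ∈ σ.1 ↔ l y + c = 0) := by
  obtain ⟨F, hF, hne⟩ := σ
  obtain ⟨l, hl⟩ := hF hne
  obtain ⟨x, hx⟩ := hne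
  have hx' := hx
  rw [hl] at hx'
  refine ⟨l, -l x, fun y hy => by linarith [hx'.2 y hy], fun y hy => ?_⟩
  change y ∈ F ↔ _
  rw [hl]
  refine ⟨fun h => by linarith [hx'.2 y hy, h.2 x hx'.1], fun h => ⟨hy, fun z hz => ?_⟩⟩
  linarith [hx'.2 z hz]

theorem Face.subset (σ : Face P) : σ.1 ⊆ P := σ.2.1.subset

/-- The face on which a nonpositive affine function vanishes. -/
def Face.ofSupport (l : StrongDual ℝ (Fin n → ℝ)) (c : ℝ) (h : ∀ y ∈ P, l y + c ≤ 0)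
    (hne : ∃ y ∈ P, l y + c = 0) : Face P :=
  ⟨{y | y ∈ P ∧ l y + c = 0}, by
    refine fun _ => ⟨l, ?_⟩
    obtain ⟨x, hx, hx0⟩ := hne
    ext y
    refine ⟨fun hy => ⟨hy.1, fun z hz => by linarith [h z hz, hy.2]⟩,
      fun hy => ⟨hy.1, le_antisymm (h y hy.1) ?_⟩⟩
    linarith [hy.2 x hx], hne⟩

theorem affine_nonpos_on_convexHull {V : Set (Fin n → ℝ)} (l : StrongDual ℝ (Fin n → ℝ)) (c : ℝ)
    (h : ∀ v ∈ V, l v + c ≤ 0) : ∀ y ∈ convexHull ℝ V, l y + c ≤ 0 := by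
  have hc : Convex ℝ {y : Fin n → ℝ | l y ≤ -c} := convex_halfSpace_le l.isLinear _
  intro y hy
  have hV : V ⊆ {y | l y ≤ -c} := fun v hv => show l v ≤ -c by linarith [h v hv]
  have hle : l y ≤ -c := convexHull_min hV hc hy
  linarith

/-- From a relative interior point the segment from any y ∈ F can be prolonged slightly beyond x
inside F. There an affine function vanishing at x has the opposite sign to its value at y. -/
theorem eq_zero_of_mem_intrinsicInterior {F : Set (Fin n → ℝ)} {x : Fin n → ℝ}
    (hx : x ∈ intrinsicInterior ℝ F) (l : StrongDual ℝ (Fin n → ℝ)) (c : ℝ)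
    (h : ∀ y ∈ F, l y + c ≤ 0) (hx0 : l x + c = 0) : ∀ y ∈ F, l y + c = 0 := by
  intro y hy
  obtain ⟨x', hx', rfl⟩ := mem_intrinsicInterior.1 hx
  let y' : affineSpan ℝ F := ⟨y, subset_affineSpan ℝ F hy⟩
  have : Nonempty (affineSpan ℝ F) := ⟨x'⟩
  have hcont : Continuous fun t : ℝ => AffineMap.lineMap x' y' t := AffineMap.lineMap_continuous
  have hmem : ∀ᶠ t : ℝ in nhds 0,
      AffineMap.lineMap x' y' t ∈ interior ((↑) ⁻¹' F : Set (affineSpan ℝ F)) := by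
    refine hcont.continuousAt.eventually_mem (isOpen_interior.mem_nhds ?_)
    simpa using hx'
  -- A negative parameter t gives a point on the side of x away from y.
  obtain ⟨t, ht, ht0⟩ := ((hmem.filter_mono nhdsWithin_le_nhds).and
    (self_mem_nhdsWithin (a := (0 : ℝ)) (s := Set.Iio 0))).exists
  have ht' : ((AffineMap.lineMap x' y' t : affineSpan ℝ F) : Fin n → ℝ) ∈ F :=
    interior_subset (s := ((↑) ⁻¹' F : Set (affineSpan ℝ F))) ht
  have e : ((AffineMap.lineMap x' y' t : affineSpan ℝ F) : Fin n → ℝ)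
      = (x' : Fin n → ℝ) + t • (y - x') := by
    simp [AffineMap.lineMap_apply, y', add_comm]
  have h1 := h _ ht'
  rw [e, map_add, map_smul, map_sub, smul_eq_mul] at h1
  have h2 := h y hy
  have ht0' : t < 0 := ht0
  nlinarith

/-- Writing y ∈ σ as a convex combination of V, the supporting function is a sum of nonpositive
terms equal to zero. So only points of V on σ carry weight. -/
theorem Face.subset_convexHull_inter {V : Finset (Fin n → ℝ)} (hP : P = convexHull ℝ (V : Set (Fin n → ℝ)))
    (σ : Face P) : σ.1 ⊆ convexHull ℝ ((V : Set (Fin n → ℝ)) ∩ σ.1) := by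
  classical
  obtain ⟨l, c, h1, h2⟩ := σ.exists_support
  intro y hy
  have hyP := σ.subset hy
  have hVP : ∀ v ∈ V, v ∈ P := fun v hv => hP ▸ subset_convexHull ℝ _ hv
  have hyV : y ∈ convexHull ℝ (V : Set (Fin n → ℝ)) := hP ▸ hyP
  obtain ⟨w, hw0, hw1, hwy⟩ := Finset.mem_convexHull'.1 hyV
  have hsum : ∑ v ∈ V, w v * (l v + c) = 0 := by
    have h3 := (h2 y hyP).1 hy
    rw [← hwy, map_sum] at h3
    simp only [map_smul, smul_eq_mul] at h3
    simp only [mul_add, Finset.sum_add_distrib, ← Finset.sum_mul, hw1, one_mul]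
    exact h3
  have hz : ∀ v ∈ V, w v * (l v + c) = 0 :=
    (Finset.sum_eq_zero_iff_of_nonpos fun v hv =>
      mul_nonpos_of_nonneg_of_nonpos (hw0 v hv) (h1 v (hVP v hv))).1 hsum
  have hout : ∀ v ∈ V, v ∉ σ.1 → w v = 0 := by
    intro v hv hvσ
    rcases mul_eq_zero.1 (hz v hv) with h4 | h4
    · exact h4
    · exact absurd ((h2 v (hVP v hv)).2 h4) hvσ
  have hset : ((V : Set (Fin n → ℝ)) ∩ σ.1) = ((V.filter (· ∈ σ.1) : Finset _) : Set (Fin n → ℝ)) := by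
    ext; simp
  rw [hset]
  refine Finset.mem_convexHull'.2 ⟨w, fun v hv => hw0 v (Finset.mem_filter.1 hv).1, ?_, ?_⟩
  · rw [← hw1]
    refine Finset.sum_subset (Finset.filter_subset _ _) fun v hv hv' => hout v hv ?_
    exact fun h => hv' (Finset.mem_filter.2 ⟨hv, h⟩)
  · rw [← hwy]
    refine Finset.sum_subset (Finset.filter_subset _ _) fun v hv hv' => ?_
    rw [hout v hv fun h => hv' (Finset.mem_filter.2 ⟨hv, h⟩), zero_smul]

theorem IsLatticePolytope.exists_vertices (hP : IsLatticePolytope P) :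
    ∃ V : Finset (Fin n → ℝ), P = convexHull ℝ (V : Set (Fin n → ℝ)) := by
  classical
  obtain ⟨s, hs⟩ := hP
  exact ⟨s.image latticeToReal, by rw [hs, Finset.coe_image]⟩

/-- A face is recovered from the members of V on it, and V is finite. -/
theorem IsLatticePolytope.finite_face (hP : IsLatticePolytope P) : Finite (Face P) := by
  obtain ⟨V, hV⟩ := hP.exists_vertices
  have key : ∀ σ τ : Face P, (V : Set (Fin n → ℝ)) ∩ σ.1 = (V : Set (Fin n → ℝ)) ∩ τ.1 →
      σ.1 ⊆ τ.1 := by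
    intro σ τ h
    have hc : Convex ℝ τ.1 := τ.2.1.convex (hV ▸ convex_convexHull ℝ _)
    refine (σ.subset_convexHull_inter hV).trans ?_
    rw [h]
    exact convexHull_min Set.inter_subset_right hc
  refine Finite.of_injective (β := Set V) (fun σ => {v | v.1 ∈ σ.1}) fun σ τ h => ?_
  have h' : (V : Set (Fin n → ℝ)) ∩ σ.1 = (V : Set (Fin n → ℝ)) ∩ τ.1 := by
    ext v
    constructor
    · rintro ⟨hv, hvσ⟩
      exact ⟨hv, (Set.ext_iff.1 h ⟨v, hv⟩).1 hvσ⟩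
    · rintro ⟨hv, hvσ⟩
      exact ⟨hv, (Set.ext_iff.1 h ⟨v, hv⟩).2 hvσ⟩
  exact Subtype.ext ((key σ τ h').antisymm (key τ σ h'.symm))

/-- Tilting a supporting hyperplane: if `φ` is positive somewhere on `F` and vanishes where the
nonpositive function `l + c` vanishes on `F`, then some tilt of `l + c` along `φ` cuts out a face of
`F` that contains a point with `φ > 0`. -/
theorem Face.exists_tilt (hP : IsLatticePolytope P) (F : Face P)
    (l φ : StrongDual ℝ (Fin n → ℝ)) (c d : ℝ) (hl : ∀ y ∈ P, l y + c ≤ 0)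
    (h0 : ∀ y ∈ F.1, l y + c = 0 → φ y + d = 0) (hpos : ∃ y ∈ F.1, 0 < φ y + d) :
    ∃ H : Face P, H ≤ F ∧ (∀ y ∈ F.1, l y + c = 0 → y ∈ H.1) ∧
      (∀ y ∈ F.1, φ y + d = 0 → l y + c < 0 → y ∉ H.1) ∧ ∃ z ∈ H.1, 0 < φ z + d := by
  classical
  obtain ⟨V, hV⟩ := hP.exists_vertices
  have hVP : ∀ v ∈ V, v ∈ P := fun v hv => hV ▸ subset_convexHull ℝ _ hv
  obtain ⟨a, e, ha1, ha2⟩ := F.exists_support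
  obtain ⟨v₀, hv₀⟩ : ∃ v ∈ V.filter (· ∈ F.1), 0 < φ v + d := by
    by_contra! hcon
    obtain ⟨y, hy, hy'⟩ := hpos
    have := affine_nonpos_on_convexHull (V := (V : Set (Fin n → ℝ)) ∩ F.1) φ d
      (fun v hv => hcon v (Finset.mem_filter.2 hv)) y (F.subset_convexHull_inter hV hy)
    linarith
  obtain ⟨z, hz, hzmin⟩ := Finset.exists_min_image
    ((V.filter (· ∈ F.1)).filter fun v => 0 < φ v + d) (fun v => -(l v + c) / (φ v + d))
    ⟨v₀, Finset.mem_filter.2 hv₀⟩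
  simp only [Finset.mem_filter] at hz hzmin
  obtain ⟨⟨hzV, hzF⟩, hzpos⟩ := hz
  -- The least ratio is the first t > 0 at which l + c + t(φ + d) reaches zero at a vertex of F with
  -- φ + d > 0; the function stays nonpositive on F.
  set t : ℝ := -(l z + c) / (φ z + d) with ht
  have hlz : l z + c < 0 := by
    refine lt_of_le_of_ne (hl z (hVP z hzV)) fun h => ?_
    rw [h0 z hzF h] at hzpos
    exact lt_irrefl _ hzpos
  have htpos : 0 < t := div_pos (by linarith) hzpos
  have htF : ∀ v ∈ V, v ∈ F.1 → (l v + c) + t * (φ v + d) ≤ 0 := by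
    intro v hv hvF
    rcases le_or_gt (φ v + d) 0 with h | h
    · have := mul_nonpos_of_nonneg_of_nonpos htpos.le h
      linarith [hl v (hVP v hv)]
    · have := (le_div_iff₀ h).1 (hzmin v ⟨⟨hv, hvF⟩, h⟩)
      linarith
  -- Off F the supporting function a + e of F is negative, so a large multiple of it restores
  -- nonpositivity at the remaining vertices.
  have hlarge : ∀ v ∈ (V : Set (Fin n → ℝ)),
      ∀ᶠ M : ℝ in Filter.atTop, M * (a v + e) + ((l v + c) + t * (φ v + d)) ≤ 0 := by
    intro v hv
    by_cases hvF : v ∈ F.1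
    · exact Filter.Eventually.of_forall fun M => by
        rw [(ha2 v (hVP v hv)).1 hvF]
        linarith [htF v hv hvF]
    · have hneg : a v + e < 0 := lt_of_le_of_ne (ha1 v (hVP v hv))
        fun h => hvF ((ha2 v (hVP v hv)).2 h)
      exact (Filter.tendsto_atBot_add_const_right _ _
        (Filter.tendsto_id.atTop_mul_const_of_neg hneg)).eventually_le_atBot 0
  obtain ⟨M, hM⟩ := ((Filter.eventually_all_finite V.finite_toSet).2 hlarge).exists
  have hMP : ∀ y ∈ P, M * (a y + e) + ((l y + c) + t * (φ y + d)) ≤ 0 := by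
    intro y hy
    have := affine_nonpos_on_convexHull (V := (V : Set (Fin n → ℝ))) (M • a + l + t • φ)
      (M * e + c + t * d) (fun v hv => by
        have := hM v hv
        simp only [add_apply, smul_apply, smul_eq_mul]
        linarith) y (hV ▸ hy)
    simp only [add_apply, smul_apply, smul_eq_mul] at this
    linarith
  -- M copies of a + e give nonpositivity on P; one more forces a + e = 0 on the zero set, so the
  -- new face lies in F.
  have heval : ∀ y, ((M + 1) • a + l + t • φ) y + ((M + 1) * e + c + t * d)
      = (a y + e) + (M * (a y + e) + ((l y + c) + t * (φ y + d))) := by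
    intro y
    simp only [add_apply, smul_apply, smul_eq_mul]
    ring
  have hz0 : (l z + c) + t * (φ z + d) = 0 := by
    rw [ht, div_mul_cancel₀ _ hzpos.ne']
    ring
  have hle : ∀ y ∈ P, ((M + 1) • a + l + t • φ) y + ((M + 1) * e + c + t * d) ≤ 0 := by
    intro y hy
    rw [heval]
    linarith [ha1 y hy, hMP y hy]
  have hzH : ((M + 1) • a + l + t • φ) z + ((M + 1) * e + c + t * d) = 0 := by
    rw [heval, hz0, (ha2 z (hVP z hzV)).1 hzF]
    ring
  refine ⟨Face.ofSupport _ _ hle ⟨z, hVP z hzV, hzH⟩, ?_, ?_, ?_, z, ⟨hVP z hzV, hzH⟩, hzpos⟩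
  · rintro y ⟨hy, hy0⟩
    rw [heval] at hy0
    exact (ha2 y hy).2 (le_antisymm (ha1 y hy) (by linarith [hMP y hy]))
  · intro y hy hy0
    refine ⟨F.subset hy, ?_⟩
    rw [heval, (ha2 y (F.subset hy)).1 hy, hy0, h0 y hy hy0]
    ring
  · rintro y hy hφ hly ⟨-, hy0⟩
    rw [heval, (ha2 y (F.subset hy)).1 hy, hφ] at hy0
    linarith

end Polytope

/-! ### Weights along a maximal chain form a basis -/

section Flags

variable {n : ℕ} {P : Set (Fin n → ℝ)}

theorem nonempty_of_affineSpan_eq_top (hdim : affineSpan ℝ P = ⊤) : P.Nonempty := by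
  by_contra h
  rw [Set.not_nonempty_iff_eq_empty] at h
  rw [h, AffineSubspace.span_empty] at hdim
  exact AffineSubspace.bot_ne_top ℝ (Fin n → ℝ) (Fin n → ℝ) hdim

/-- `P` as a face of itself. -/
def topFace (hne : P.Nonempty) : Face P := ⟨P, IsExposed.refl P, hne⟩

theorem topFace_mem_flag (hne : P.Nonempty) (ch : Flag (Face P)) : topFace hne ∈ ch :=
  Flag.mem_iff_forall_le_or_ge.2 fun τ _ => Or.inr (show τ.1 ⊆ P from τ.subset)

/-- For a member `F` of a maximal chain there is a nonpositive affine function on `P` whose zero set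
is the union of the smaller members of the chain. -/
theorem exists_support_of_lt [Finite (Face P)] {x : Face P → Fin n → ℝ}
    (hx : ∀ σ, x σ ∈ intrinsicInterior ℝ σ.1) (ch : Flag (Face P)) (F : Face P) :
    ∃ (l : StrongDual ℝ (Fin n → ℝ)) (c : ℝ), (∀ y ∈ P, l y + c ≤ 0) ∧ l (x F) + c < 0 ∧
      (∀ τ ∈ ch, τ < F → ∀ y ∈ τ.1, l y + c = 0) ∧
      (∀ y ∈ P, l y + c = 0 → ∃ τ ∈ ch, τ < F ∧ y ∈ τ.1) := by
  by_cases hne : {τ | τ ∈ ch ∧ τ < F}.Nonempty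
  · obtain ⟨G, ⟨hG, hGF⟩, hGmax⟩ := (Set.toFinite {τ | τ ∈ ch ∧ τ < F}).exists_maximal hne
    obtain ⟨l, c, h1, h2⟩ := G.exists_support
    have hxF : x F ∈ F.1 := intrinsicInterior_subset (hx F)
    refine ⟨l, c, h1, lt_of_le_of_ne (h1 _ (F.subset hxF)) fun h => ?_, fun τ hτ hτF y hy => ?_,
      fun y hy h => ⟨G, hG, hGF, (h2 y hy).2 h⟩⟩
    · have h3 := eq_zero_of_mem_intrinsicInterior (hx F) l c (fun y hy => h1 y (F.subset hy)) h
      exact hGF.not_ge fun y hy => (h2 y (F.subset hy)).2 (h3 y hy)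
    · have hτG : τ ≤ G := by
        rcases ch.le_or_le hτ hG with h | h
        · exact h
        · exact hGmax ⟨hτ, hτF⟩ h
      exact (h2 y (τ.subset hy)).1 (hτG hy)
  -- If F is the least member of the chain, the constant -1 serves: its zero set is empty.
  · refine ⟨0, -1, fun y _ => by simp, by simp, fun τ hτ hτF => ?_, fun y _ h => by simp at h⟩
    exact absurd ⟨τ, hτ, hτF⟩ hne

/-- Induction along the chain replaces dimension counting. Suppose the function vanishes on the
smaller members and at x_F but is positive somewhere on F. Tilting gives a face H < F that contains
all smaller members and a point where the function is positive. H is comparable with the whole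
chain, so maximality puts H in it, which contradicts the induction hypothesis. The argument is
applied to φ + d and to its negative, which is why `key` is stated for a second pair ψ, e with the
same zeros. -/
theorem affine_eq_zero_on_flag (hP : IsLatticePolytope P) {x : Face P → Fin n → ℝ}
    (hx : ∀ σ, x σ ∈ intrinsicInterior ℝ σ.1) (ch : Flag (Face P))
    (φ : StrongDual ℝ (Fin n → ℝ)) (d : ℝ) (hφ : ∀ σ ∈ ch, φ (x σ) + d = 0) :
    ∀ σ ∈ ch, ∀ y ∈ σ.1, φ y + d = 0 := by
  have : Finite (Face P) := hP.finite_face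
  have key : ∀ F ∈ ch, (∀ τ ∈ ch, τ < F → ∀ y ∈ τ.1, φ y + d = 0) →
      ∀ (ψ : StrongDual ℝ (Fin n → ℝ)) (e : ℝ), (∀ y, φ y + d = 0 ↔ ψ y + e = 0) →
      ∀ y ∈ F.1, ψ y + e ≤ 0 := by
    intro F hF ih ψ e hψ y hy
    by_contra! hpos
    obtain ⟨l, c, h1, h2, h3, h4⟩ := exists_support_of_lt hx ch F
    obtain ⟨H, hHF, hH1, hH2, z, hzH, hz⟩ := F.exists_tilt hP l ψ c e h1 (fun y hy h0 => by
      obtain ⟨τ, hτ, hτF, hyτ⟩ := h4 y (F.subset hy) h0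
      exact (hψ y).1 (ih τ hτ hτF y hyτ)) ⟨y, hy, hpos⟩
    have hxF : x F ∈ F.1 := intrinsicInterior_subset (hx F)
    have hlt : H < F := lt_of_le_of_ne hHF fun h =>
      hH2 (x F) hxF ((hψ _).1 (hφ F hF)) h2 (h ▸ hxF)
    have hmem : H ∈ ch := by
      refine Flag.mem_iff_forall_le_or_ge.2 fun τ hτ => ?_
      rcases ch.le_or_le hτ hF with h | h
      · rcases h.eq_or_lt with rfl | h
        · exact Or.inl hHF
        · exact Or.inr fun y hy => hH1 y (h.le hy) (h3 τ hτ h y hy)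
      · exact Or.inl (hHF.trans h)
    exact hz.ne' ((hψ z).1 (ih H hmem hlt z hzH))
  intro σ
  induction σ using WellFoundedLT.induction with
  | ind F ih =>
    intro hF y hy
    have ih' : ∀ τ ∈ ch, τ < F → ∀ y ∈ τ.1, φ y + d = 0 := fun τ hτ hτF => ih τ hτF hτ
    have h1 := key F hF ih' φ d (fun _ => Iff.rfl) y hy
    have h2 := key F hF ih' (-φ) (-d) (fun y => by
      simp only [neg_apply]
      constructor <;> intro h <;> linarith) y hy
    simp only [neg_apply] at h2
    linarith

theorem affine_eq_zero (hP : IsLatticePolytope P) (hdim : affineSpan ℝ P = ⊤)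
    {x : Face P → Fin n → ℝ} (hx : ∀ σ, x σ ∈ intrinsicInterior ℝ σ.1) (ch : Flag (Face P))
    (φ : StrongDual ℝ (Fin n → ℝ)) (d : ℝ) (hφ : ∀ σ ∈ ch, φ (x σ) + d = 0) :
    φ = 0 ∧ d = 0 := by
  have h : ∀ y ∈ P, φ y + d = 0 := affine_eq_zero_on_flag hP hx ch φ d hφ _
    (topFace_mem_flag (nonempty_of_affineSpan_eq_top hdim) ch)
  have h' : ∀ y, φ y + d = 0 := by
    intro y
    have hy : y ∈ affineSpan ℝ P := hdim ▸ AffineSubspace.mem_top ℝ _ y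
    refine affineSpan_induction (p := fun y => φ y + d = 0) hy h ?_
    intro c u v w hu hv hw
    simp only [vsub_eq_sub, vadd_eq_add, map_add, map_smul, map_sub, smul_eq_mul]
    rw [show φ u = φ v by linarith]
    simpa using hw
  have hd : d = 0 := by simpa using h' 0
  refine ⟨ContinuousLinearMap.ext fun y => ?_, hd⟩
  simpa [hd] using h' y

/-- Triangularity: at the greatest F in the support, test with an affine function that vanishes on
the smaller members but not at x_F. -/
theorem linearIndependent_on_flag [Finite (Face P)] {x : Face P → Fin n → ℝ}
    (hx : ∀ σ, x σ ∈ intrinsicInterior ℝ σ.1) (ch : Flag (Face P)) (a : Face P →₀ ℝ)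
    (ha : ∀ σ ∈ a.support, σ ∈ ch)
    (h0 : ∀ (l : StrongDual ℝ (Fin n → ℝ)) (c : ℝ), (a.sum fun σ q => q * (l (x σ) + c)) = 0) :
    a = 0 := by
  by_contra hne
  obtain ⟨F, hF, hFmax⟩ := a.support.finite_toSet.exists_maximal
    (Finset.coe_nonempty.2 (Finsupp.support_nonempty_iff.2 hne))
  obtain ⟨l, c, h1, h2, h3, h4⟩ := exists_support_of_lt hx ch F
  have h5 := h0 l c
  rw [Finsupp.sum, Finset.sum_eq_single_of_mem F hF] at h5
  · rcases mul_eq_zero.1 h5 with h6 | h6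
    · exact Finsupp.mem_support_iff.1 hF h6
    · exact h2.ne h6
  · intro τ hτ hτF
    have hle : τ ≤ F := by
      rcases ch.le_or_le (ha τ hτ) (ha F hF) with h | h
      · exact h
      · exact hFmax hτ h
    rw [h3 τ (ha τ hτ) (lt_of_le_of_ne hle hτF) _ (intrinsicInterior_subset (hx τ)), mul_zero]

theorem dual_apply_eq_sum (l : StrongDual ℝ (Fin n → ℝ)) (y : Fin n → ℝ) :
    l y = ∑ i, y i * l (Pi.single i 1) := by
  conv_lhs => rw [pi_eq_sum_univ' y]
  simp [map_sum]

variable {K : Type*} [Field K] (S : CombSeshadriStratification K P)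

theorem CombSeshadriStratification.degree_ne_zero (σ : Face P) : ((S.μ σ).1 : ℝ) ≠ 0 := by
  have := S.one_le_degree σ
  exact_mod_cast (by omega : (S.μ σ).1 ≠ 0)

/-- The point `-μ_σ / deg f_σ` of the face `σ`. -/
def CombSeshadriStratification.point (σ : Face P) : Fin n → ℝ :=
  fun i => (-((S.μ σ).2 i) : ℝ) / (-((S.μ σ).1) : ℝ)

theorem CombSeshadriStratification.mul_affine_point (σ : Face P) (l : StrongDual ℝ (Fin n → ℝ))
    (c : ℝ) : ((S.μ σ).1 : ℝ) * (l (S.point σ) + c)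
      = ∑ i, ((S.μ σ).2 i : ℝ) * l (Pi.single i 1) + (S.μ σ).1 * c := by
  have h := S.degree_ne_zero σ
  rw [dual_apply_eq_sum, mul_add, Finset.mul_sum]
  congr 1
  refine Finset.sum_congr rfl fun i _ => ?_
  rw [CombSeshadriStratification.point, neg_div_neg_eq, ← mul_assoc, mul_div_cancel₀ _ h]

theorem linearIndependent_weights [Finite (Face P)] (ch : Flag (Face P)) (a : Face P →₀ ℚ)
    (ha : ∀ σ ∈ a.support, σ ∈ ch) (h0 : (a.sum fun σ q => q • ratWeight (S.μ σ)) = 0) :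
    a = 0 := by
  have h01 : ∑ σ ∈ a.support, (a σ : ℝ) * ((S.μ σ).1 : ℝ) = 0 := by
    have := congrArg Prod.fst h0
    simp only [Finsupp.sum, Prod.fst_sum, Prod.smul_fst, ratWeight, smul_eq_mul, Prod.fst_zero] at this
    exact_mod_cast this
  have h02 : ∀ i, ∑ σ ∈ a.support, (a σ : ℝ) * ((S.μ σ).2 i : ℝ) = 0 := by
    intro i
    have := congrFun (congrArg Prod.snd h0) i
    simp only [Finsupp.sum, Prod.snd_sum, Prod.smul_snd, ratWeight, Finset.sum_apply, Pi.smul_apply,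
      smul_eq_mul, Prod.snd_zero, Pi.zero_apply] at this
    exact_mod_cast this
  -- Scaling by the first coordinates of the weights turns a linear relation among the μ_σ into an
  -- affine relation among the points -μ_σ / deg f_σ.
  let b : Face P →₀ ℝ := Finsupp.onFinset a.support (fun σ => (a σ : ℝ) * ((S.μ σ).1 : ℝ))
    fun σ h => Finsupp.mem_support_iff.2 fun h' => h (by simp [h'])
  have hb : b = 0 := by
    refine linearIndependent_on_flag (x := S.point) S.mem_relint ch b
      (fun σ hσ => ha σ (Finsupp.support_onFinset_subset hσ)) fun l c => ?_
    rw [Finsupp.onFinset_sum _ (fun _ => zero_mul _)]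
    simp only [mul_assoc, S.mul_affine_point]
    simp only [mul_add, Finset.sum_add_distrib, Finset.mul_sum]
    rw [Finset.sum_comm]
    simp only [← mul_assoc, ← Finset.sum_mul, h01, h02]
    simp
  ext σ
  have h1 : (a σ : ℝ) * ((S.μ σ).1 : ℝ) = 0 := DFunLike.congr_fun hb σ
  exact_mod_cast (mul_eq_zero.1 h1).resolve_right (S.degree_ne_zero σ)

/-- A functional killing all weights of the chain is, after dehomogenising, an affine function
vanishing at all points of the chain, hence zero. -/
theorem span_weights (hP : IsLatticePolytope P) (hdim : affineSpan ℝ P = ⊤)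
    (ch : Flag (Face P)) :
    Submodule.span ℚ ((fun σ => ratWeight (S.μ σ)) '' (ch : Set (Face P))) = ⊤ := by
  by_contra hne
  obtain ⟨f, hf0, hf⟩ := Submodule.exists_le_ker_of_lt_top _ (lt_top_iff_ne_top.2 hne)
  have hfsum : ∀ v : ℚ × (Fin n → ℚ), f v = v.1 * f (1, 0) + ∑ i, v.2 i * f (0, Pi.single i 1) := by
    intro v
    have h1 : v = v.1 • ((1 : ℚ), (0 : Fin n → ℚ))
        + ∑ i, v.2 i • ((0 : ℚ), (Pi.single i 1 : Fin n → ℚ)) := by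
      refine Prod.ext ?_ ?_
      · simp [Prod.fst_sum]
      · simp only [Prod.snd_add, Prod.smul_snd, smul_zero, zero_add, Prod.snd_sum]
        exact pi_eq_sum_univ' v.2
    conv_lhs => rw [h1]
    simp only [map_add, map_sum, map_smul, smul_eq_mul]
  let φ : StrongDual ℝ (Fin n → ℝ) :=
    ∑ i, ((f (0, Pi.single i 1) : ℚ) : ℝ) • ContinuousLinearMap.proj i
  have hφ : ∀ i, φ (Pi.single i 1) = ((f (0, Pi.single i 1) : ℚ) : ℝ) := by
    intro i
    simp only [φ, sum_apply, smul_apply, ContinuousLinearMap.proj_apply,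
      smul_eq_mul]
    rw [Finset.sum_eq_single i] <;> simp +contextual
  obtain ⟨h1, h2⟩ := affine_eq_zero hP hdim (x := S.point) S.mem_relint ch φ
    ((f (1, 0) : ℚ) : ℝ) fun σ hσ => by
      have h3 : f (ratWeight (S.μ σ)) = 0 := hf (Submodule.subset_span ⟨σ, hσ, rfl⟩)
      rw [hfsum] at h3
      have h4 := S.mul_affine_point σ φ ((f (1, 0) : ℚ) : ℝ)
      simp only [hφ] at h4
      have h5 : ∑ i, ((S.μ σ).2 i : ℝ) * ((f (0, Pi.single i 1) : ℚ) : ℝ)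
          + ((S.μ σ).1 : ℝ) * ((f (1, 0) : ℚ) : ℝ) = 0 := by
        rw [add_comm]
        simp only [ratWeight] at h3
        exact_mod_cast h3
      rw [h5] at h4
      exact (mul_eq_zero.1 h4).resolve_left (S.degree_ne_zero σ)
  refine hf0 (LinearMap.ext fun v => ?_)
  have h3 : ∀ i, f (0, Pi.single i 1) = 0 := fun i => by
    have := hφ i
    rw [h1, zero_apply] at this
    exact_mod_cast this.symm
  have h4 : f (1, 0) = 0 := by exact_mod_cast h2
  simp [hfsum v, h3, h4]

theorem chainCoord_spec (hP : IsLatticePolytope P) (hdim : affineSpan ℝ P = ⊤)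
    (ch : Flag (Face P)) (w : HatM n) :
    (∀ σ ∈ (chainCoord S ch w).support, σ ∈ ch) ∧
      ((chainCoord S ch w).sum fun σ q => q • ratWeight (S.μ σ)) = ratWeight w := by
  refine Classical.epsilon_spec (p := fun a : Face P →₀ ℚ => (∀ σ ∈ a.support, σ ∈ ch) ∧
    (a.sum fun σ q => q • ratWeight (S.μ σ)) = ratWeight w) ?_
  have h : ratWeight w ∈ Submodule.span ℚ ((fun σ => ratWeight (S.μ σ)) '' (ch : Set (Face P))) := by
    rw [span_weights S hP hdim]
    trivial
  obtain ⟨a, ha, h'⟩ := (Finsupp.mem_span_image_iff_linearCombination ℚ).1 h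
  exact ⟨a, fun σ hσ => (Finsupp.mem_supported ℚ a).1 ha hσ, h'⟩

theorem ratWeight_add (w w' : HatM n) : ratWeight (w + w') = ratWeight w + ratWeight w' := by
  refine Prod.ext ?_ (funext fun i => ?_) <;> simp [ratWeight]

/-- Uniqueness of coordinates; this is the source of the superadditivity of ν. -/
theorem chainCoord_add (hP : IsLatticePolytope P) (hdim : affineSpan ℝ P = ⊤)
    (ch : Flag (Face P)) (w w' : HatM n) :
    chainCoord S ch (w + w') = chainCoord S ch w + chainCoord S ch w' := by
  classical
  have := hP.finite_face
  obtain ⟨h1, h2⟩ := chainCoord_spec S hP hdim ch w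
  obtain ⟨h3, h4⟩ := chainCoord_spec S hP hdim ch w'
  obtain ⟨h5, h6⟩ := chainCoord_spec S hP hdim ch (w + w')
  have hsum : ∀ a : Face P →₀ ℚ, (a.sum fun σ q => q • ratWeight (S.μ σ))
    = Finsupp.linearCombination ℚ (fun σ => ratWeight (S.μ σ)) a := fun _ => rfl
  refine sub_eq_zero.1 (linearIndependent_weights S ch _ (fun σ hσ => ?_) ?_)
  · rcases Finset.mem_union.1 (Finsupp.support_sub hσ) with h | h
    · exact h5 σ h
    · rcases Finset.mem_union.1 (Finsupp.support_add h) with h | h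
      · exact h1 σ h
      · exact h3 σ h
  · rw [hsum] at h2 h4 h6 ⊢
    rw [map_sub, map_add, h2, h4, h6, ratWeight_add, sub_self]

end Flags

/-! ### The coordinate ring as a subalgebra of the group algebra of `ℤ ⊕ M` -/

section CoordRing

variable {K : Type*} [Field K] {n : ℕ} {P : Set (Fin n → ℝ)}

theorem generator_mem_weightMonoid (χ : Lam P) : ((1 : ℤ), χ.1) ∈ weightMonoid P := by
  refine AddSubmonoid.mem_closure.2 fun s hs => hs ?_
  exact ⟨rfl, χ.2⟩

/-- The character `(a, χ)` of `T̂` as a monoid homomorphism to `K`. -/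
def hatCharHom (K : Type*) [Field K] {n : ℕ} (w : HatM n) : Kˣ × (Fin n → Kˣ) →* K where
  toFun s := (hatChar w s.1 s.2 : Kˣ)
  map_one' := by simp [hatChar, torusChar]
  map_mul' s t := by
    rw [← Units.val_mul]
    congr 1
    simp only [hatChar, torusChar, Prod.fst_mul, Prod.snd_mul, Pi.mul_apply, mul_zpow,
      Finset.prod_mul_distrib]
    exact mul_mul_mul_comm _ _ _ _

theorem hatChar_add (w w' : HatM n) (c : Kˣ) (t : Fin n → Kˣ) :
    hatChar (w + w') c t = hatChar w c t * hatChar w' c t := by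
  simp only [hatChar, torusChar, Prod.fst_add, Prod.snd_add, Pi.add_apply, zpow_add,
    Finset.prod_mul_distrib]
  exact mul_mul_mul_comm _ _ _ _

theorem hatChar_zero (c : Kˣ) (t : Fin n → Kˣ) : hatChar (0 : HatM n) c t = 1 := by
  simp [hatChar, torusChar]

theorem hatChar_neg (w : HatM n) (c : Kˣ) (t : Fin n → Kˣ) :
    hatChar (-w) c t = (hatChar w c t)⁻¹ :=
  eq_inv_of_mul_eq_one_left (by rw [← hatChar_add, neg_add_cancel, hatChar_zero])

theorem two_zpow_injective [CharZero K] {a b : ℤ} (h : (2 : K) ^ a = 2 ^ b) : a = b := by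
  have h1 : (((2 : ℚ) ^ a : ℚ) : K) = ((2 : ℚ) ^ b : ℚ) := by push_cast; exact h
  exact zpow_right_injective₀ (by norm_num) (by norm_num) (Rat.cast_injective h1)

/-- Exponents are read off at points with one coordinate 2 and the others 1; in characteristic zero
the powers of 2 are distinct. -/
theorem hatCharHom_injective [CharZero K] : Function.Injective (hatCharHom K (n := n)) := by
  intro w w' h
  have key : ∀ (c : Kˣ) (t : Fin n → Kˣ), hatChar w c t = hatChar w' c t :=
    fun c t => Units.ext (DFunLike.congr_fun h (c, t))
  let two : Kˣ := Units.mk0 2 two_ne_zero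
  have inj : ∀ a b : ℤ, two ^ a = two ^ b → a = b := fun a b hab => by
    have := congrArg (fun u : Kˣ => (u : K)) hab
    simp only [Units.val_zpow_eq_zpow_val, two, Units.val_mk0] at this
    exact two_zpow_injective this
  refine Prod.ext (inj _ _ ?_) (funext fun i => inj _ _ ?_)
  · simpa [hatChar, torusChar] using key two 1
  · have hs : ∀ u : HatM n, hatChar u (1 : Kˣ) (Pi.mulSingle i two) = two ^ u.2 i := by
      intro u
      rw [hatChar, torusChar, one_zpow, one_mul, Finset.prod_eq_single i]
      · simp
      · intro j _ hj
        simp [Pi.mulSingle_eq_of_ne hj]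
      · simp
    simpa [hs] using key 1 (Pi.mulSingle i two)

/-- Evaluation of an element of the group algebra of `ℤ ⊕ M` at a point of `T̂`. -/
def groupEval (c : Kˣ) (t : Fin n → Kˣ) : AddMonoidAlgebra K (HatM n) →ₐ[K] K :=
  AddMonoidAlgebra.lift K K (HatM n)
    { toFun := fun w => (hatChar w.toAdd c t : Kˣ)
      map_one' := by simp [hatChar_zero]
      map_mul' := fun w w' => by rw [toAdd_mul, hatChar_add, Units.val_mul] }

theorem groupEval_single (c : Kˣ) (t : Fin n → Kˣ) (w : HatM n) (k : K) :
    groupEval c t (AddMonoidAlgebra.single w k) = k * (hatChar w c t : Kˣ) := by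
  simp [groupEval]

theorem groupEval_apply (c : Kˣ) (t : Fin n → Kˣ) (F : AddMonoidAlgebra K (HatM n)) :
    groupEval c t F = F.coeff.sum fun w k => k * hatCharHom K w (c, t) :=
  AddMonoidAlgebra.lift_apply _ _

/-- Dedekind's linear independence of characters. -/
theorem eq_zero_of_groupEval_eq_zero [CharZero K] {F : AddMonoidAlgebra K (HatM n)}
    (h : ∀ c t, groupEval c t F = 0) : F = 0 := by
  have hli := (linearIndependent_monoidHom (Kˣ × (Fin n → Kˣ)) K).comp _
    (hatCharHom_injective (K := K) (n := n))
  have h0 : F.coeff = 0 := by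
    refine linearIndependent_iff.1 hli F.coeff (funext fun s => ?_)
    have := h s.1 s.2
    rw [groupEval_apply] at this
    rw [Finsupp.linearCombination_apply, Finsupp.sum, Finset.sum_apply]
    exact this
  exact AddMonoidAlgebra.coeff_eq_zero.1 h0

/-- The morphism `K[V] → K[ℤ ⊕ M]`, `x_χ ↦ z^{(1, χ)}`. -/
def polyToGroup (K : Type*) [Field K] {n : ℕ} (P : Set (Fin n → ℝ)) :
    MvPolynomial (Lam P) K →ₐ[K] AddMonoidAlgebra K (HatM n) :=
  aeval fun χ => AddMonoidAlgebra.single ((1 : ℤ), χ.1) 1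

theorem aeval_single_monomial {σ : Type*} (w : σ → HatM n) (a : σ →₀ ℕ) (k : K) :
    aeval (fun χ => (AddMonoidAlgebra.single (w χ) 1 : AddMonoidAlgebra K (HatM n)))
      (monomial a k) = AddMonoidAlgebra.single (Finsupp.weight w a) k := by
  have h : ∀ b : σ →₀ ℕ, (b.prod fun i e =>
      (AddMonoidAlgebra.single (w i) 1 : AddMonoidAlgebra K (HatM n)) ^ e)
      = AddMonoidAlgebra.single (Finsupp.weight w b) 1 := by
    intro b
    induction b using Finsupp.induction_linear with
    | zero => simp [AddMonoidAlgebra.one_def]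
    | add f g hf hg =>
      rw [Finsupp.prod_add_index' (by simp) (by intros; rw [pow_add]), hf, hg, map_add,
        AddMonoidAlgebra.single_mul_single, one_mul]
    | single i e =>
      rw [Finsupp.prod_single_index (by simp), AddMonoidAlgebra.single_pow, one_pow,
        Finsupp.weight_single]
  rw [aeval_monomial, h, AddMonoidAlgebra.coe_algebraMap]
  simp [AddMonoidAlgebra.single_mul_single]

theorem polyToGroup_monomial (a : Lam P →₀ ℕ) (k : K) :
    polyToGroup K P (monomial a k)
      = AddMonoidAlgebra.single (Finsupp.weight (fun χ : Lam P => ((1 : ℤ), χ.1)) a) k :=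
  aeval_single_monomial _ _ _

theorem groupEval_polyToGroup (c : Kˣ) (t : Fin n → Kˣ) (f : MvPolynomial (Lam P) K) :
    groupEval c t (polyToGroup K P f) = aeval (hatIota K P c t) f := by
  have : (groupEval c t).comp (polyToGroup K P) = aeval (hatIota K P c t) := by
    ext χ
    simp [polyToGroup, groupEval_single, hatIota, hatChar]
  exact DFunLike.congr_fun this f

theorem mem_coneIdeal_iff_polyToGroup [CharZero K] {f : MvPolynomial (Lam P) K} :
    f ∈ coneIdeal K P ↔ polyToGroup K P f = 0 := by
  rw [mem_coneIdeal_iff]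
  constructor
  · intro h
    exact eq_zero_of_groupEval_eq_zero fun c t => by rw [groupEval_polyToGroup, h]
  · intro h c t
    rw [← groupEval_polyToGroup, h, map_zero]

/-- The dual action of `T̂` on the group algebra. -/
def groupTwist (c : Kˣ) (t : Fin n → Kˣ) :
    AddMonoidAlgebra K (HatM n) →ₐ[K] AddMonoidAlgebra K (HatM n) :=
  AddMonoidAlgebra.lift K _ (HatM n)
    { toFun := fun w => AddMonoidAlgebra.single w.toAdd ((hatChar (-w.toAdd) c t : Kˣ) : K)
      map_one' := by simp [hatChar_zero, AddMonoidAlgebra.one_def]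
      map_mul' := fun w w' => by
        rw [toAdd_mul, neg_add, hatChar_add, Units.val_mul, AddMonoidAlgebra.single_mul_single] }

theorem groupTwist_single (c : Kˣ) (t : Fin n → Kˣ) (w : HatM n) (k : K) :
    groupTwist c t (AddMonoidAlgebra.single w k)
      = AddMonoidAlgebra.single w (k * (hatChar (-w) c t : Kˣ)) := by
  simp [groupTwist]

theorem coeff_groupTwist (c : Kˣ) (t : Fin n → Kˣ) (F : AddMonoidAlgebra K (HatM n))
    (u : HatM n) : (groupTwist c t F).coeff u = F.coeff u * (hatChar (-u) c t : Kˣ) := by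
  classical
  induction F using AddMonoidAlgebra.induction_linear with
  | zero => simp
  | add f g hf hg => simp only [map_add, AddMonoidAlgebra.coeff_add, Finsupp.add_apply, hf, hg, add_mul]
  | single w k =>
    rw [groupTwist_single, AddMonoidAlgebra.coeff_single, AddMonoidAlgebra.coeff_single,
      Finsupp.single_apply, Finsupp.single_apply]
    split_ifs with h
    · rw [h]
    · rw [zero_mul]

variable [CharZero K]

/-- The embedding `K[X̂_P] → K[ℤ ⊕ M]`. -/
def toGroup (K : Type*) [Field K] [CharZero K] {n : ℕ} (P : Set (Fin n → ℝ)) :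
    CoordRing K P →ₐ[K] AddMonoidAlgebra K (HatM n) :=
  Ideal.Quotient.liftₐ (coneIdeal K P) (polyToGroup K P)
    fun _ h => mem_coneIdeal_iff_polyToGroup.1 h

theorem toGroup_mk (f : MvPolynomial (Lam P) K) :
    toGroup K P (Ideal.Quotient.mk (coneIdeal K P) f) = polyToGroup K P f := rfl

theorem toGroup_injective : Function.Injective (toGroup K P) := by
  refine (injective_iff_map_eq_zero _).2 fun g hg => ?_
  obtain ⟨f, rfl⟩ := Ideal.Quotient.mk_surjective g
  exact Ideal.Quotient.eq_zero_iff_mem.2 (mem_coneIdeal_iff_polyToGroup.2 hg)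

/-- The coefficients of an element of `K[X̂_P]` in the basis `f_{m,η}`. -/
def coordCoeff (g : CoordRing K P) : HatM n →₀ K := (toGroup K P g).coeff

theorem coordCoeff_injective : Function.Injective (coordCoeff (K := K) (P := P)) :=
  AddMonoidAlgebra.coeff_injective.comp toGroup_injective

theorem coordCoeff_zero : coordCoeff (0 : CoordRing K P) = 0 := by
  rw [coordCoeff, map_zero, AddMonoidAlgebra.coeff_zero]

theorem coordCoeff_eq_zero_iff {g : CoordRing K P} : coordCoeff g = 0 ↔ g = 0 :=
  ⟨fun h => coordCoeff_injective (h.trans coordCoeff_zero.symm), fun h => h ▸ coordCoeff_zero⟩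

theorem coordCoeff_add (g g' : CoordRing K P) :
    coordCoeff (g + g') = coordCoeff g + coordCoeff g' := by
  simp only [coordCoeff, map_add, AddMonoidAlgebra.coeff_add]

theorem coordCoeff_smul (k : K) (g : CoordRing K P) :
    coordCoeff (k • g) = k • coordCoeff g := by
  simp only [coordCoeff, map_smul, AddMonoidAlgebra.coeff_smul]

theorem coordCoeff_sum {ι : Type*} (s : Finset ι) (g : ι → CoordRing K P) :
    coordCoeff (∑ i ∈ s, g i) = ∑ i ∈ s, coordCoeff (g i) := by
  simp only [coordCoeff, map_sum, AddMonoidAlgebra.coeff_sum]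

theorem exists_weight_eq_iff (w : HatM n) :
    (∃ a : Lam P →₀ ℕ, Finsupp.weight (fun χ : Lam P => ((1 : ℤ), χ.1)) a = w)
      ↔ w ∈ weightMonoid P := by
  constructor
  · rintro ⟨a, rfl⟩
    rw [Finsupp.weight_apply]
    exact AddSubmonoid.sum_mem _ fun χ _ => AddSubmonoid.nsmul_mem _ (generator_mem_weightMonoid χ) _
  · intro h
    induction h using AddSubmonoid.closure_induction with
    | mem w hw =>
      refine ⟨Finsupp.single ⟨w.2, hw.2⟩ 1, ?_⟩
      rw [Finsupp.weight_single, one_smul]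
      exact Prod.ext hw.1.symm rfl
    | zero => exact ⟨0, map_zero _⟩
    | add w w' _ _ h h' =>
      obtain ⟨a, rfl⟩ := h
      obtain ⟨b, rfl⟩ := h'
      exact ⟨a + b, map_add _ _ _⟩

theorem mem_weightMonoid_of_coordCoeff_ne_zero {g : CoordRing K P} {w : HatM n}
    (h : coordCoeff g w ≠ 0) : w ∈ weightMonoid P := by
  classical
  obtain ⟨f, rfl⟩ := Ideal.Quotient.mk_surjective g
  rw [coordCoeff, toGroup_mk, f.as_sum, map_sum, AddMonoidAlgebra.coeff_sum, Finset.sum_apply'] at h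
  obtain ⟨a, -, ha⟩ := Finset.exists_ne_zero_of_sum_ne_zero h
  rw [polyToGroup_monomial, AddMonoidAlgebra.coeff_single] at ha
  exact (exists_weight_eq_iff w).1 ⟨a, (Finsupp.single_apply_ne_zero.1 ha).1.symm⟩

theorem toGroup_basisFn {w : HatM n} (hw : w ∈ weightMonoid P) :
    toGroup K P (basisFn K P w) = AddMonoidAlgebra.single w 1 := by
  have h := (exists_weight_eq_iff w).2 hw
  rw [basisFn, dif_pos h, toGroup_mk, polyToGroup_monomial, h.choose_spec]

theorem coordCoeff_basisFn {w : HatM n} (hw : w ∈ weightMonoid P) :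
    coordCoeff (basisFn K P w) = Finsupp.single w 1 := by
  rw [coordCoeff, toGroup_basisFn hw, AddMonoidAlgebra.coeff_single]

theorem basisFn_ne_zero {w : HatM n} (hw : w ∈ weightMonoid P) : basisFn K P w ≠ 0 := by
  intro h
  have := coordCoeff_basisFn (K := K) hw
  rw [h, coordCoeff_zero] at this
  simpa using DFunLike.congr_fun this w

theorem basisFn_mul {w w' : HatM n} (hw : w ∈ weightMonoid P) (hw' : w' ∈ weightMonoid P) :
    basisFn K P w * basisFn K P w' = basisFn K P (w + w') := by
  apply toGroup_injective
  rw [map_mul, toGroup_basisFn hw, toGroup_basisFn hw', toGroup_basisFn (add_mem hw hw'),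
    AddMonoidAlgebra.single_mul_single, one_mul]

theorem sum_coordCoeff_smul_basisFn (g : CoordRing K P) :
    ∑ w ∈ (coordCoeff g).support, coordCoeff g w • basisFn K P w = g := by
  apply coordCoeff_injective
  rw [coordCoeff_sum]
  conv_rhs => rw [← Finsupp.sum_single (coordCoeff g)]
  refine Finset.sum_congr rfl fun w hw => ?_
  rw [coordCoeff_smul, coordCoeff_basisFn
    (mem_weightMonoid_of_coordCoeff_ne_zero (Finsupp.mem_support_iff.1 hw)), Finsupp.smul_single,
    smul_eq_mul, mul_one]

theorem coordCoeff_hatAct (c : Kˣ) (t : Fin n → Kˣ) (g : CoordRing K P) (u : HatM n) :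
    coordCoeff (hatAct K P c t g) u = coordCoeff g u * (hatChar (-u) c t : Kˣ) := by
  have h : (toGroup K P).comp ((hatAct K P c t).comp (Ideal.Quotient.mkₐ K (coneIdeal K P)))
      = (groupTwist c t).comp (polyToGroup K P) := by
    ext1 χ
    have h1 : hatAct K P c t (Ideal.Quotient.mk (coneIdeal K P) (X χ))
        = Ideal.Quotient.mk (coneIdeal K P) (polyAct K P c t (X χ)) := rfl
    simp only [AlgHom.comp_apply, Ideal.Quotient.mkₐ_eq_mk, h1, toGroup_mk]
    simp only [polyAct, polyToGroup, aeval_X, map_mul, algHom_C, groupTwist_single, hatChar_neg,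
      AddMonoidAlgebra.coe_algebraMap]
    simp [AddMonoidAlgebra.single_mul_single, hatChar]
  obtain ⟨f, rfl⟩ := Ideal.Quotient.mk_surjective g
  rw [coordCoeff, coordCoeff, ← coeff_groupTwist]
  exact congrArg (fun F => F.coeff u) (DFunLike.congr_fun h f)

/-- The action on functions is by inverses, so the basis function with exponent u has weight -u.
This is the origin of the signs in `mem_weightsOf_iff` and `monoVal`. -/
theorem isEigen_iff {w : HatM n} {g : CoordRing K P} :
    IsEigen w g ↔ ∀ u, coordCoeff g u ≠ 0 → u = -w := by
  constructor
  · intro h u hu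
    have h1 : hatCharHom K (-u) = hatCharHom K w := by
      ext ⟨c, t⟩
      have h2 := congrArg (fun x => coordCoeff x u) (h c t)
      simp only [coordCoeff_hatAct] at h2
      rw [← Algebra.smul_def, coordCoeff_smul, Finsupp.smul_apply, smul_eq_mul, mul_comm] at h2
      exact mul_right_cancel₀ hu h2
    rw [← hatCharHom_injective h1, neg_neg]
  · intro h c t
    apply coordCoeff_injective
    ext u
    rw [coordCoeff_hatAct, ← Algebra.smul_def, coordCoeff_smul, Finsupp.smul_apply, smul_eq_mul]
    by_cases hu : coordCoeff g u = 0
    · rw [hu, zero_mul, mul_zero]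
    · rw [h u hu, neg_neg, mul_comm]

theorem mem_weightsOf_iff {w : HatM n} {g : CoordRing K P} :
    w ∈ weightsOf g ↔ coordCoeff g (-w) ≠ 0 := by
  classical
  constructor
  · rintro ⟨d, h1, rfl, h3⟩
    rw [Finsupp.sum, coordCoeff_sum, Finset.sum_apply',
      Finset.sum_eq_single_of_mem w (Finsupp.mem_support_iff.2 h3)]
    · intro h4
      refine h3 (coordCoeff_eq_zero_iff.1 (Finsupp.ext fun u => ?_))
      by_contra h5
      exact h5 (isEigen_iff.1 (h1 w) u h5 ▸ h4)
    · intro η _ hη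
      by_contra h5
      exact hη (neg_injective (isEigen_iff.1 (h1 η) _ h5)).symm
  · intro h
    refine ⟨Finsupp.onFinset ((coordCoeff g).support.image Neg.neg)
      (fun η => coordCoeff g (-η) • basisFn K P (-η)) ?_, ?_, ?_, ?_⟩
    · intro η hη
      refine Finset.mem_image.2 ⟨-η, Finsupp.mem_support_iff.2 fun h0 => hη ?_, neg_neg η⟩
      rw [h0, zero_smul]
    · intro η
      rw [isEigen_iff, Finsupp.onFinset_apply]
      intro u hu
      by_cases h0 : coordCoeff g (-η) = 0
      · rw [h0, zero_smul, coordCoeff_zero] at hu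
        exact absurd rfl hu
      · rw [coordCoeff_smul, coordCoeff_basisFn (mem_weightMonoid_of_coordCoeff_ne_zero h0),
          Finsupp.smul_single] at hu
        exact (Finsupp.single_apply_ne_zero.1 hu).1
    · rw [Finsupp.onFinset_sum _ (fun _ => rfl), Finset.sum_image neg_injective.injOn]
      simp only [neg_neg]
      exact sum_coordCoeff_smul_basisFn g
    · rw [Finsupp.onFinset_apply]
      exact smul_ne_zero h (basisFn_ne_zero (mem_weightMonoid_of_coordCoeff_ne_zero h))

end CoordRing

/-! ### The quasi-valuation on the basis functions -/

section Valuation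

variable {K : Type*} [Field K] {n : ℕ} {P : Set (Fin n → ℝ)}
  (S : CombSeshadriStratification K P) (r : Face P → Face P → Prop)

/-- The minimum over all maximal chains of the coordinates of `-w`. -/
def monoVal (w : HatM n) : Face P →₀ ℚ :=
  lexMin r (Set.range fun ch : Flag (Face P) => chainCoord S ch (-w))

theorem term_mul_term (a b : Face P →₀ ℚ) (g h : CoordRing K P) :
    GroupAlg.term a g * GroupAlg.term b h = GroupAlg.term (a + b) (g * h) :=
  AddMonoidAlgebra.single_mul_single _ _ _ _

theorem finite_flag (hP : IsLatticePolytope P) : Finite (Flag (Face P)) := by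
  have := hP.finite_face
  exact Finite.of_injective (fun ch : Flag (Face P) => (ch : Set (Face P))) SetLike.coe_injective

variable [IsStrictTotalOrder (Face P) r]

theorem monoVal_spec (hP : IsLatticePolytope P) (w : HatM n) :
    (∃ ch, chainCoord S ch (-w) = monoVal S r w) ∧
      ∀ ch, lexLE r (monoVal S r w) (chainCoord S ch (-w)) := by
  have := finite_flag hP
  have h := lexMin_spec (r := r)
    (Set.finite_range fun ch : Flag (Face P) => chainCoord S ch (-w)) (Set.range_nonempty _)
  exact ⟨h.1, fun ch => h.2 _ ⟨ch, rfl⟩⟩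

theorem monoVal_add_le (hP : IsLatticePolytope P) (hdim : affineSpan ℝ P = ⊤) (w w' : HatM n) :
    lexLE r (monoVal S r w + monoVal S r w') (monoVal S r (w + w')) := by
  obtain ⟨ch, hch⟩ := (monoVal_spec S r hP (w + w')).1
  rw [← hch, neg_add, chainCoord_add S hP hdim]
  exact ((monoVal_spec S r hP w).2 ch).add ((monoVal_spec S r hP w').2 ch)

theorem monoVal_zero (hP : IsLatticePolytope P) (hdim : affineSpan ℝ P = ⊤) :
    monoVal S r 0 = 0 := by
  obtain ⟨ch, hch⟩ := (monoVal_spec S r hP 0).1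
  have h := chainCoord_add S hP hdim ch 0 0
  rw [add_zero, left_eq_add] at h
  rw [← hch, neg_zero, h]

variable [CharZero K]

/-- Interchange of two minima: over chains and over the weights occurring in g. -/
theorem quasiVal_spec (hP : IsLatticePolytope P) {g : CoordRing K P} (hg : g ≠ 0) :
    (∃ u, coordCoeff g u ≠ 0 ∧ quasiVal S r g = monoVal S r u) ∧
      ∀ u, coordCoeff g u ≠ 0 → lexLE r (quasiVal S r g) (monoVal S r u) := by
  classical
  have := finite_flag hP
  have hfin : (weightsOf g).Finite := by
    refine ((coordCoeff g).support.image Neg.neg).finite_toSet.subset fun w hw => ?_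
    exact Finset.mem_coe.2 (Finset.mem_image.2
      ⟨-w, Finsupp.mem_support_iff.2 (mem_weightsOf_iff.1 hw), neg_neg w⟩)
  have hne : (weightsOf g).Nonempty := by
    obtain ⟨u, hu⟩ := Finsupp.ne_iff.1 fun h => hg (coordCoeff_eq_zero_iff.1 h)
    exact ⟨-u, mem_weightsOf_iff.2 (by rwa [neg_neg])⟩
  have h1 : ∀ ch, (∃ w ∈ weightsOf g, chainCoord S ch w = chainVal S r ch g) ∧
      ∀ w ∈ weightsOf g, lexLE r (chainVal S r ch g) (chainCoord S ch w) := fun ch => by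
    have h := lexMin_spec (r := r) (hfin.image (chainCoord S ch)) (hne.image _)
    exact ⟨h.1, fun w hw => h.2 _ ⟨w, hw, rfl⟩⟩
  have h2 := lexMin_spec (r := r)
    (Set.finite_range fun ch : Flag (Face P) => chainVal S r ch g) (Set.range_nonempty _)
  have hle : ∀ u, coordCoeff g u ≠ 0 → lexLE r (quasiVal S r g) (monoVal S r u) := by
    intro u hu
    obtain ⟨ch, hch⟩ := (monoVal_spec S r hP u).1
    rw [← hch]
    exact (h2.2 _ ⟨ch, rfl⟩).trans ((h1 ch).2 _ (mem_weightsOf_iff.2 (by rwa [neg_neg])))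
  refine ⟨?_, hle⟩
  obtain ⟨ch, hch⟩ := h2.1
  obtain ⟨w, hw, hw'⟩ := (h1 ch).1
  have hu := mem_weightsOf_iff.1 hw
  refine ⟨-w, hu, (hle _ hu).antisymm ?_⟩
  have h3 : chainCoord S ch w = quasiVal S r g := hw'.trans hch
  rw [← h3]
  simpa using (monoVal_spec S r hP (-w)).2 ch

theorem quasiVal_basisFn (hP : IsLatticePolytope P) {w : HatM n} (hw : w ∈ weightMonoid P) :
    quasiVal S r (basisFn K P w) = monoVal S r w := by
  obtain ⟨⟨u, hu, h⟩, -⟩ := quasiVal_spec S r hP (basisFn_ne_zero (K := K) hw)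
  rw [coordCoeff_basisFn hw] at hu
  rw [h, (Finsupp.single_apply_ne_zero.1 hu).1]

/-! ### The associated graded algebra -/

/-- `g ↦ g z^a` as a linear map. -/
def termLin (K : Type*) [Field K] {n : ℕ} {P : Set (Fin n → ℝ)} (a : Face P →₀ ℚ) :
    CoordRing K P →ₗ[K] GroupAlg K P where
  toFun := GroupAlg.term a
  map_add' := AddMonoidAlgebra.single_add a
  map_smul' k g := (AddMonoidAlgebra.smul_single k a g).symm

/-- The span of the `f_u z^a` with `a ≤ ν(f_u)`. -/
def reesSpan : Submodule K (GroupAlg K P) :=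
  Submodule.span K {F | ∃ a u, u ∈ weightMonoid P ∧ lexLE r a (monoVal S r u) ∧
    F = GroupAlg.term a (basisFn K P u)}

/-- The span of the `f_u z^a` with `a < ν(f_u)`. -/
def reesIdealSpan : Submodule K (GroupAlg K P) :=
  Submodule.span K {F | ∃ a u, u ∈ weightMonoid P ∧ lexLT r a (monoVal S r u) ∧
    F = GroupAlg.term a (basisFn K P u)}

theorem term_eq_sum (a : Face P →₀ ℚ) (g : CoordRing K P) :
    GroupAlg.term a g
      = ∑ u ∈ (coordCoeff g).support, coordCoeff g u • GroupAlg.term a (basisFn K P u) := by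
  conv_lhs => rw [← sum_coordCoeff_smul_basisFn g]
  change termLin K a _ = _
  rw [map_sum]
  simp only [map_smul]
  rfl

theorem basisFn_zero : basisFn K P 0 = 1 := by
  apply toGroup_injective
  rw [toGroup_basisFn (zero_mem _), map_one, AddMonoidAlgebra.one_def]

theorem reesSpan_mul (hP : IsLatticePolytope P) (hdim : affineSpan ℝ P = ⊤)
    {F G : GroupAlg K P} (hF : F ∈ reesSpan S r) (hG : G ∈ reesSpan S r) :
    F * G ∈ reesSpan S r := by
  have h := Submodule.mul_mem_mul hF hG
  rw [reesSpan, Submodule.span_mul_span] at h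
  refine Submodule.span_mono ?_ h
  rintro _ ⟨_, ⟨a, u, hu, hau, rfl⟩, _, ⟨b, v, hv, hbv, rfl⟩, rfl⟩
  exact ⟨a + b, u + v, add_mem hu hv, (hau.add hbv).trans (monoVal_add_le S r hP hdim u v),
    by simp only [term_mul_term, basisFn_mul hu hv]⟩

theorem reesSpan_mul_reesIdealSpan (hP : IsLatticePolytope P) (hdim : affineSpan ℝ P = ⊤)
    {F G : GroupAlg K P} (hF : F ∈ reesSpan S r) (hG : G ∈ reesIdealSpan S r) :
    F * G ∈ reesIdealSpan S r := by
  have h := Submodule.mul_mem_mul hF hG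
  rw [reesSpan, reesIdealSpan, Submodule.span_mul_span] at h
  refine Submodule.span_mono ?_ h
  rintro _ ⟨_, ⟨a, u, hu, hau, rfl⟩, _, ⟨b, v, hv, hbv, rfl⟩, rfl⟩
  refine ⟨a + b, u + v, add_mem hu hv, ?_, by simp only [term_mul_term, basisFn_mul hu hv]⟩
  exact lexLT_of_lexLE_of_lexLT (hau.add (Or.inl rfl)) (lexLT_of_lexLT_of_lexLE
    ((lexLT_add_left_iff _).2 hbv) (monoVal_add_le S r hP hdim u v))

theorem mem_reesSpan_of_mem (hP : IsLatticePolytope P) (hdim : affineSpan ℝ P = ⊤)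
    {F : GroupAlg K P} (hF : F ∈ reesAlgebra S r) : F ∈ reesSpan S r := by
  induction hF using Algebra.adjoin_induction with
  | mem F hF =>
    obtain ⟨a, g, hg, ha, rfl⟩ := hF
    rw [term_eq_sum]
    refine Submodule.sum_mem _ fun u hu => Submodule.smul_mem _ _ (Submodule.subset_span ?_)
    have hu' := Finsupp.mem_support_iff.1 hu
    exact ⟨a, u, mem_weightMonoid_of_coordCoeff_ne_zero hu',
      lexLE.trans ha ((quasiVal_spec S r hP hg).2 u hu'), rfl⟩
  | algebraMap k =>
    rw [Algebra.algebraMap_eq_smul_one]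
    refine Submodule.smul_mem _ _ (Submodule.subset_span ?_)
    exact ⟨0, 0, zero_mem _, Or.inl (monoVal_zero S r hP hdim).symm, by rw [basisFn_zero]; rfl⟩
  | add F G _ _ hF hG => exact add_mem hF hG
  | mul F G _ _ hF hG => exact reesSpan_mul S r hP hdim hF hG

theorem mem_reesIdealSpan_of_mem (hP : IsLatticePolytope P) (hdim : affineSpan ℝ P = ⊤)
    {F : reesAlgebra S r} (hF : F ∈ reesIdeal S r) : (F : GroupAlg K P) ∈ reesIdealSpan S r := by
  induction hF using Submodule.span_induction with
  | mem F hF =>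
    obtain ⟨a, g, hg, ha, h⟩ := hF
    rw [h, term_eq_sum]
    refine Submodule.sum_mem _ fun u hu => Submodule.smul_mem _ _ (Submodule.subset_span ?_)
    have hu' := Finsupp.mem_support_iff.1 hu
    exact ⟨a, u, mem_weightMonoid_of_coordCoeff_ne_zero hu',
      lexLT_of_lexLT_of_lexLE ha ((quasiVal_spec S r hP hg).2 u hu'), rfl⟩
  | zero => exact zero_mem _
  | add F G _ _ hF hG => exact add_mem hF hG
  | smul F G _ hG =>
    exact reesSpan_mul_reesIdealSpan S r hP hdim (mem_reesSpan_of_mem S r hP hdim F.2) hG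

/-- The coefficient of `f_w z^a`. -/
def termCoeff (a : Face P →₀ ℚ) (w : HatM n) : GroupAlg K P →ₗ[K] K where
  toFun F := coordCoeff (AddMonoidAlgebra.coeff (F : AddMonoidAlgebra (CoordRing K P) (Face P →₀ ℚ)) a) w
  map_add' F G := by
    rw [← Finsupp.add_apply, ← coordCoeff_add]
    rfl
  map_smul' k F := by
    rw [RingHom.id_apply, ← Finsupp.smul_apply, ← coordCoeff_smul]
    rfl

open Classical in
theorem termCoeff_term_basisFn (a b : Face P →₀ ℚ) (w : HatM n) {u : HatM n}
    (hu : u ∈ weightMonoid P) :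
    termCoeff a w (GroupAlg.term b (basisFn K P u)) = if u = w ∧ b = a then 1 else 0 := by
  have h : termCoeff a w (GroupAlg.term b (basisFn K P u))
      = coordCoeff ((Finsupp.single b (basisFn K P u)) a) w := rfl
  rw [h, Finsupp.single_apply]
  by_cases hb : b = a
  · rw [if_pos hb, coordCoeff_basisFn hu, Finsupp.single_apply]
    simp [hb]
  · rw [if_neg hb, coordCoeff_zero]
    simp [hb]

/-- The ideal is spanned by terms f_u z^a with a < ν(f_u), so reading the coefficient of f_w at the
exact degree ν(f_w) descends to gr_ν. These functionals detect the independence of the classes of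
the f_w. -/
theorem termCoeff_eq_zero_of_mem_reesIdeal (hP : IsLatticePolytope P)
    (hdim : affineSpan ℝ P = ⊤) {F : reesAlgebra S r} (hF : F ∈ reesIdeal S r) (w : HatM n) :
    termCoeff (monoVal S r w) w (F : GroupAlg K P) = 0 := by
  have h : reesIdealSpan S r ≤ LinearMap.ker (termCoeff (K := K) (monoVal S r w) w) := by
    refine Submodule.span_le.2 ?_
    rintro _ ⟨a, u, hu, ha, rfl⟩
    rw [SetLike.mem_coe, LinearMap.mem_ker, termCoeff_term_basisFn _ _ _ hu, if_neg]
    rintro ⟨rfl, rfl⟩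
    exact irrefl_of (lexLT r) _ ha
  exact h (mem_reesIdealSpan_of_mem S r hP hdim hF)

end Valuation

/-! ### Initial ideals of lattice ideals -/

section InitialIdeals

variable {K : Type*} [Field K] {p : ℕ}

open Classical in
/-- The sum of the coefficients of a polynomial at the monomials with exponents in `A`. -/
def coeffSum (K : Type*) [Field K] {p : ℕ} (A : Set (Fin p →₀ ℕ)) :
    MvPolynomial (Fin p) K →ₗ[K] K :=
  (basisMonomials (Fin p) K).constr K fun α => if α ∈ A then 1 else 0

open Classical in
theorem coeffSum_monomial (A : Set (Fin p →₀ ℕ)) (α : Fin p →₀ ℕ) (k : K) :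
    coeffSum K A (monomial α k) = if α ∈ A then k else 0 := by
  have h : monomial α k = k • basisMonomials (Fin p) K α := by
    rw [coe_basisMonomials, smul_monomial, smul_eq_mul, mul_one]
  rw [h, map_smul, coeffSum, Module.Basis.constr_basis, smul_eq_mul, mul_ite, mul_one, mul_zero]

open Classical in
theorem coeffSum_sum_monomial (A : Set (Fin p →₀ ℕ)) (s : Finset (Fin p →₀ ℕ))
    (k : (Fin p →₀ ℕ) → K) :
    coeffSum K A (∑ α ∈ s, monomial α (k α)) = ∑ α ∈ s with α ∈ A, k α := by
  rw [map_sum, Finset.sum_filter]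
  exact Finset.sum_congr rfl fun α _ => coeffSum_monomial A α _

open Classical in
theorem coeffSum_apply (A : Set (Fin p →₀ ℕ)) (g : MvPolynomial (Fin p) K) :
    coeffSum K A g = ∑ α ∈ g.support with α ∈ A, coeff α g := by
  conv_lhs => rw [g.as_sum]
  exact coeffSum_sum_monomial A _ _

open Classical in
-- Grouping the terms of g by fibre, φ(g) is the combination of the B(w) whose coefficients are the
-- sums assumed to vanish.
theorem linearMap_eq_zero_of_coeffSum {M ι : Type*} [AddCommGroup M] [Module K M]
    (φ : MvPolynomial (Fin p) K →ₗ[K] M) (W : (Fin p →₀ ℕ) → ι) (E : Set (Fin p →₀ ℕ)) (B : ι → M)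
    (hφ : ∀ α, φ (monomial α 1) = if α ∈ E then B (W α) else 0) {g : MvPolynomial (Fin p) K}
    (hg : ∀ w, coeffSum K {α | W α = w ∧ α ∈ E} g = 0) : φ g = 0 := by
  have hmon : ∀ α (k : K), φ (monomial α k) = if α ∈ E then k • B (W α) else 0 := by
    intro α k
    have h : monomial α k = k • (monomial α (1 : K)) := by
      rw [smul_monomial, smul_eq_mul, mul_one]
    rw [h, map_smul, hφ, smul_ite, smul_zero]
  rw [g.as_sum, map_sum]
  simp only [hmon]
  rw [← Finset.sum_filter, ← Finset.sum_fiberwise_of_maps_to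
    (t := g.support.image W) (g := W)
    fun α hα => Finset.mem_image_of_mem W (Finset.mem_filter.1 hα).1]
  refine Finset.sum_eq_zero fun w _ => ?_
  have h := hg w
  rw [coeffSum_apply] at h
  rw [Finset.sum_congr rfl (g := fun α => coeff α g • B w)
    fun α hα => by rw [(Finset.mem_filter.1 hα).2], ← Finset.sum_smul]
  convert zero_smul K (B w) using 2
  rw [← h, Finset.filter_filter]
  refine Finset.sum_congr (Finset.ext fun α => ?_) fun _ _ => rfl
  simp only [Finset.mem_filter, Set.mem_ofPred_eq]
  exact and_congr_right fun _ => and_comm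

/-- A polynomial lies in an ideal if its coefficient sums over the lowest parts of all fibres vanish
and the ideal contains the monomials outside these parts and the binomials inside them. -/
theorem mem_ideal_of_coeffSum {ι : Type*} {W : (Fin p →₀ ℕ) → ι} {E : Set (Fin p →₀ ℕ)}
    {I : Ideal (MvPolynomial (Fin p) K)} (hmon : ∀ α ∉ E, monomial α (1 : K) ∈ I)
    (hbin : ∀ α β, W α = W β → α ∈ E → β ∈ E → monomial α (1 : K) - monomial β 1 ∈ I)
    {g : MvPolynomial (Fin p) K} (hg : ∀ w, coeffSum K {α | W α = w ∧ α ∈ E} g = 0) : g ∈ I := by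
  classical
  refine (Ideal.Quotient.eq_zero_iff_mem (I := I)).1 ?_
  -- All monomials of E in one fibre have the same class modulo I; the value 0 on fibres missing E
  -- is never used.
  let rep : ι → MvPolynomial (Fin p) K ⧸ I := fun w =>
    if h : ∃ α ∈ E, W α = w then Ideal.Quotient.mk _ (monomial h.choose 1) else 0
  refine linearMap_eq_zero_of_coeffSum (Ideal.Quotient.mkₐ K I).toLinearMap W E rep ?_ hg
  intro α
  change Ideal.Quotient.mk _ (monomial α 1) = _
  split_ifs with hα
  · have h : ∃ β ∈ E, W β = W α := ⟨α, hα, rfl⟩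
    simp only [rep, dif_pos h]
    exact Ideal.Quotient.eq.2 (hbin _ _ h.choose_spec.2.symm hα h.choose_spec.1)
  · exact Ideal.Quotient.eq_zero_iff_mem.2 (hmon α hα)

/-- The initial ideal of `J` is `J₀` for every order that makes the exponents in the lowest part of
a fibre of `W` equivalent to each other and lower than the rest of the fibre. Here `J` consists of
the polynomials whose coefficient sums over all fibres of `W` vanish, and `J₀` of those whose
coefficient sums over the lowest parts `E` of the fibres vanish. -/
theorem initialIdeal_eq {ι : Type*} {W : (Fin p →₀ ℕ) → ι} {E : Set (Fin p →₀ ℕ)}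
    {J J₀ : Ideal (MvPolynomial (Fin p) K)}
    (hJ : ∀ g, g ∈ J ↔ ∀ w, coeffSum K {α | W α = w} g = 0)
    (hJ₀ : ∀ g, g ∈ J₀ ↔ ∀ w, coeffSum K {α | W α = w ∧ α ∈ E} g = 0)
    (hE : ∀ α, ∃ β ∈ E, W β = W α)
    {lt : (Fin p →₀ ℕ) → (Fin p →₀ ℕ) → Prop} (hasymm : ∀ α β, lt α β → ¬ lt β α)
    (hlt : ∀ α β, W α = W β → α ∈ E → β ∉ E → lt α β)
    (heq : ∀ α β γ, W α = W β → α ∈ E → β ∈ E → (lt α γ ↔ lt β γ)) :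
    initialIdeal lt J = J₀ := by
  classical
  have hirrefl : ∀ α, ¬ lt α α := fun α h => hasymm α α h h
  apply le_antisymm
  · refine Ideal.span_le.2 ?_
    rintro _ ⟨g, hg, -, rfl⟩
    refine (hJ₀ _).2 fun w => ?_
    rw [initialForm, coeffSum_sum_monomial, Finset.filter_filter]
    -- If an exponent of E in the fibre w is maximal in g, then all exponents of g in that fibre lie
    -- in E and are maximal too. The sum is then the full fibre sum of g, which is zero. Otherwise
    -- the sum is empty.
    by_cases hex : ∃ α ∈ g.support, (∀ β ∈ g.support, ¬ lt α β) ∧ W α = w ∧ α ∈ E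
    · obtain ⟨α, hα, hmax, rfl, hαE⟩ := hex
      rw [← (hJ g).1 hg (W α), coeffSum_apply]
      refine Finset.sum_congr (Finset.ext fun β => ?_) fun _ _ => rfl
      simp only [Finset.mem_filter, Set.mem_ofPred_eq]
      refine and_congr_right fun hβ => ⟨fun h => h.2.1, fun h => ?_⟩
      have hβE : β ∈ E := by
        by_contra hβE
        exact hmax β hβ (hlt α β h.symm hαE hβE)
      exact ⟨fun γ hγ h' => hmax γ hγ ((heq β α γ h hβE hαE).1 h'), h, hβE⟩
    · refine Finset.sum_eq_zero fun α hα => absurd ?_ hex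
      simp only [Finset.mem_filter, Set.mem_ofPred_eq] at hα
      obtain ⟨h1, h2, h3⟩ := hα
      exact ⟨α, h1, h2, h3⟩
  · intro g hg
    choose b hbE hbW using hE
    have hbin : ∀ α β, W α = W β → monomial α (1 : K) - monomial β 1 ∈ J := by
      intro α β h
      refine (hJ _).2 fun w => ?_
      rw [map_sub, coeffSum_monomial, coeffSum_monomial]
      simp [h]
    have hsub : ∀ α β : Fin p →₀ ℕ, α ≠ β → monomial α (1 : K) - monomial β 1 ≠ 0 := by
      intro α β h h0
      exact h (monomial_left_injective one_ne_zero (sub_eq_zero.1 h0))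
    have hsupp : ∀ α β : Fin p →₀ ℕ, α ≠ β →
        (monomial α (1 : K) - monomial β 1).support = {α, β} := by
      intro α β h
      ext γ
      simp only [mem_support_iff, coeff_sub, coeff_monomial, Finset.mem_insert,
        Finset.mem_singleton]
      by_cases h1 : α = γ
      · subst h1
        simp [h.symm]
      · by_cases h2 : β = γ
        · subst h2
          simp [h]
        · simp [h1, h2, Ne.symm h1, Ne.symm h2]
    have hmem : ∀ α ∉ E, monomial α (1 : K) ∈ initialIdeal lt J := by
      intro α hα
      have hne : α ≠ b α := fun h => hα (h ▸ hbE α)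
      have hl := hlt (b α) α (hbW α) (hbE α) hα
      refine Ideal.subset_span ⟨_, hbin α (b α) (hbW α).symm, hsub _ _ hne, ?_⟩
      rw [initialForm, hsupp _ _ hne, Finset.filter_insert, Finset.filter_singleton, if_pos, if_neg]
      · simp [coeff_monomial, hne.symm]
      · simp [hl]
      · simpa [hirrefl] using hasymm _ _ hl
    have hmem' : ∀ α β, W α = W β → α ∈ E → β ∈ E →
        monomial α (1 : K) - monomial β 1 ∈ initialIdeal lt J := by
      intro α β hW hα hβ
      by_cases hne : α = β
      · rw [hne, sub_self]
        exact zero_mem _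
      refine Ideal.subset_span ⟨_, hbin α β hW, hsub _ _ hne, ?_⟩
      have h1 : ¬ lt α β := fun h => hirrefl β ((heq α β β hW hα hβ).1 h)
      have h2 : ¬ lt β α := fun h => hirrefl α ((heq β α α hW.symm hβ hα).1 h)
      rw [initialForm, Finset.filter_true_of_mem, ← as_sum]
      rw [hsupp _ _ hne]
      simp [h1, h2, hirrefl]
    exact mem_ideal_of_coeffSum hmem hmem' ((hJ₀ g).1 hg)

/-- Exponents in the lowest part of a fibre are separated from the others by a linear functional. -/
theorem exists_linear_separating {ι Γ : Type*} [AddCommGroup ι] [AddCommGroup Γ] [Module ℚ Γ]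
    (W : (Fin p →₀ ℕ) →+ ι) (ν : (Fin p →₀ ℕ) →+ Γ) (E : Set (Fin p →₀ ℕ))
    (hE : ∀ α, ∃ β ∈ E, W β = W α)
    (hνE : ∀ α ∈ E, ∀ β ∈ E, W α = W β → ν α = ν β)
    (hfin : ∀ α, {β | W β = W α}.Finite)
    (hpos : ∀ V : Set ((Fin p →₀ ℕ) × (Fin p →₀ ℕ)), V.Finite →
      (∀ v ∈ V, W v.1 = W v.2 ∧ v.1 ∉ E ∧ v.2 ∈ E) →
      ∃ L : Γ →ₗ[ℚ] ℚ, ∀ v ∈ V, L (ν v.1) < L (ν v.2)) :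
    ∃ L : Γ →ₗ[ℚ] ℚ, ∀ α β, W α = W β → α ∉ E → β ∈ E → L (ν α) < L (ν β) := by
  choose b hbE hbW using hE
  -- Dickson's lemma: minimal exponents form an antichain in ℕ^p.
  have hM : {α | Minimal (· ∉ E) α}.Finite :=
    (setOfPred_minimal_antichain _).finite_of_wellQuasiOrdered wellQuasiOrdered_le
  obtain ⟨L, hL⟩ := hpos ((fun α => (α, b α)) '' {α | Minimal (· ∉ E) α}) (hM.image _) (by
    rintro _ ⟨α, hα, rfl⟩
    have hα' : Minimal (· ∉ E) α := hα
    exact ⟨(hbW α).symm, hα'.prop, hbE α⟩)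
  refine ⟨L, fun α β hW hα hβ => ?_⟩
  -- Replacing a minimal inexact part μ of γ by an exponent of E in its fibre keeps W and raises L ∘
  -- ν. Hence the maximum of L ∘ ν on a finite fibre is attained on E, where ν is constant.
  have hup : ∀ γ, γ ∉ E → ∃ δ, W δ = W γ ∧ L (ν γ) < L (ν δ) := by
    intro γ hγ
    obtain ⟨μ, hμγ, hμ⟩ := exists_minimal_le_of_wellFoundedLT (· ∉ E) γ hγ
    obtain ⟨δ, rfl⟩ := exists_add_of_le hμγ
    refine ⟨b μ + δ, by rw [map_add, map_add, hbW], ?_⟩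
    rw [map_add, map_add, map_add, map_add]
    exact add_lt_add_left (hL _ ⟨μ, hμ, rfl⟩) _
  obtain ⟨γ, hγ, hmax⟩ := Set.exists_max_image _ (fun γ => L (ν γ)) (hfin α) ⟨α, rfl⟩
  have hγE : γ ∈ E := by
    by_contra h
    obtain ⟨δ, hδ, hlt⟩ := hup γ h
    exact (hmax δ (hδ.trans hγ)).not_gt hlt
  obtain ⟨δ, hδ, hlt⟩ := hup α hα
  rw [hνE β hβ γ hγE (hW.symm.trans hγ.symm)]
  exact hlt.trans_le (hmax δ hδ)

end InitialIdeals

/-! ### The kernels of `θ` and `θ̄` -/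

section Kernels

theorem exponent_induction {p : ℕ} {C : (Fin p →₀ ℕ) → Prop} (h0 : C 0)
    (h1 : ∀ i, C (Finsupp.single i 1)) (hadd : ∀ α β, C α → C β → C (α + β)) (α) : C α := by
  induction α using Finsupp.induction_linear with
  | zero => exact h0
  | add f g hf hg => exact hadd f g hf hg
  | single i e =>
    induction e with
    | zero => rwa [Finsupp.single_zero]
    | succ e ih =>
      rw [Finsupp.single_add]
      exact hadd _ _ ih (h1 i)

section

variable {K : Type*} [Field K] {n : ℕ} {P : Set (Fin n → ℝ)} {p : ℕ}
  (S : CombSeshadriStratification K P) (r : Face P → Face P → Prop)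

/-- The lift of `θ̄` to the algebra `⨁_a K[X̂_P]_{≥ a} z^a`. -/
def reesTheta (w : Fin p → HatM n) : MvPolynomial (Fin p) K →ₐ[K] reesAlgebra S r :=
  aeval fun i => ⟨GroupAlg.term (quasiVal S r (basisFn K P (w i))) (basisFn K P (w i)),
    single_mem_reesAlgebra S r _⟩

theorem thetaBar_eq (w : Fin p → HatM n) (g : MvPolynomial (Fin p) K) :
    thetaBar S r w g = Ideal.Quotient.mk (reesIdeal S r) (reesTheta S r w g) := by
  have h : thetaBar S r w = (Ideal.Quotient.mkₐ K (reesIdeal S r)).comp (reesTheta S r w) := by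
    ext1 i
    simp only [thetaBar, reesTheta, AlgHom.comp_apply, aeval_X]
    rfl
  rw [h]
  rfl

end

variable {K : Type*} [Field K] {n : ℕ} {P : Set (Fin n → ℝ)} {p : ℕ} {w : Fin p → HatM n}

theorem weight_mem_weightMonoid (hw : ∀ i, w i ∈ weightMonoid P) (α : Fin p →₀ ℕ) :
    Finsupp.weight w α ∈ weightMonoid P := by
  induction α using exponent_induction with
  | h0 => rw [map_zero]; exact zero_mem _
  | h1 i => rw [Finsupp.weight_single, one_smul]; exact hw i
  | hadd α β hα hβ => rw [map_add]; exact add_mem hα hβ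

variable [CharZero K]

theorem toGroup_theta (hw : ∀ i, w i ∈ weightMonoid P) (g : MvPolynomial (Fin p) K) :
    toGroup K P (theta K P w g)
      = aeval (fun i => (AddMonoidAlgebra.single (w i) 1 : AddMonoidAlgebra K (HatM n))) g := by
  have h : (toGroup K P).comp (theta K P w)
      = aeval fun i => (AddMonoidAlgebra.single (w i) 1 : AddMonoidAlgebra K (HatM n)) := by
    ext1 i
    simp only [AlgHom.comp_apply, theta, aeval_X, toGroup_basisFn (hw i)]
  exact DFunLike.congr_fun h g

theorem coordCoeff_theta (hw : ∀ i, w i ∈ weightMonoid P) (g : MvPolynomial (Fin p) K)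
    (u : HatM n) :
    coordCoeff (theta K P w g) u = coeffSum K {α | Finsupp.weight w α = u} g := by
  classical
  rw [coordCoeff, toGroup_theta hw]
  conv_lhs => rw [g.as_sum]
  rw [map_sum, AddMonoidAlgebra.coeff_sum, Finset.sum_apply', coeffSum_apply, Finset.sum_filter]
  refine Finset.sum_congr rfl fun α _ => ?_
  rw [aeval_single_monomial, AddMonoidAlgebra.coeff_single, Finsupp.single_apply]
  simp only [Set.mem_ofPred_eq]
  congr

theorem mem_ker_theta_iff (hw : ∀ i, w i ∈ weightMonoid P) (g : MvPolynomial (Fin p) K) :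
    g ∈ RingHom.ker (theta K P w) ↔ ∀ u, coeffSum K {α | Finsupp.weight w α = u} g = 0 := by
  rw [RingHom.mem_ker, ← coordCoeff_eq_zero_iff, Finsupp.ext_iff]
  exact forall_congr' fun u => by rw [coordCoeff_theta hw, Finsupp.zero_apply]

theorem eval_hatChar (hw : ∀ i, w i ∈ weightMonoid P) (c : Kˣ) (t : Fin n → Kˣ)
    (g : MvPolynomial (Fin p) K) :
    eval (fun i => ((hatChar (w i) c t : Kˣ) : K)) g
      = groupEval c t (toGroup K P (theta K P w g)) := by
  have h : (groupEval c t).comp ((toGroup K P).comp (theta K P w))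
      = aeval fun i => ((hatChar (w i) c t : Kˣ) : K) := by
    ext1 i
    simp only [AlgHom.comp_apply, theta, aeval_X, toGroup_basisFn (hw i), groupEval_single, one_mul]
  rw [← coe_aeval_eq_eval]
  exact (DFunLike.congr_fun h g).symm

variable (S : CombSeshadriStratification K P) (r : Face P → Face P → Prop)

/-- The value `∑ α_i ν(f_{m_i, χ_i})` of an exponent. -/
def expVal (w : Fin p → HatM n) : (Fin p →₀ ℕ) →+ (Face P →₀ ℚ) :=
  Finsupp.weight fun i => quasiVal S r (basisFn K P (w i))

/-- The exponents `α` with `∑ α_i ν(f_i) = ν(∏ f_i ^ α_i)`. -/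
def exactExps (w : Fin p → HatM n) : Set (Fin p →₀ ℕ) :=
  {α | expVal S r w α = monoVal S r (Finsupp.weight w α)}

theorem coe_reesTheta_monomial (hw : ∀ i, w i ∈ weightMonoid P) (α : Fin p →₀ ℕ) :
    (reesTheta S r w (monomial α 1) : GroupAlg K P)
      = GroupAlg.term (expVal S r w α) (basisFn K P (Finsupp.weight w α)) := by
  induction α using exponent_induction with
  | h0 =>
    rw [map_zero, map_zero, basisFn_zero, show monomial 0 (1 : K) = 1 from rfl, map_one]
    rfl
  | h1 i =>
    change ((reesTheta S r w (X i) : reesAlgebra S r) : GroupAlg K P) = _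
    rw [reesTheta, aeval_X, expVal, Finsupp.weight_single, Finsupp.weight_single, one_smul, one_smul]
  | hadd α β hα hβ =>
    have h : monomial (α + β) (1 : K) = monomial α 1 * monomial β 1 := by
      rw [monomial_mul, one_mul]
    rw [h, map_mul, MulMemClass.coe_mul, hα, hβ, term_mul_term, map_add, map_add,
      basisFn_mul (weight_mem_weightMonoid hw α) (weight_mem_weightMonoid hw β)]

theorem termCoeff_reesTheta (hw : ∀ i, w i ∈ weightMonoid P) (g : MvPolynomial (Fin p) K)
    (u : HatM n) : termCoeff (monoVal S r u) u (reesTheta S r w g : GroupAlg K P)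
      = coeffSum K {α | Finsupp.weight w α = u ∧ α ∈ exactExps S r w} g := by
  classical
  conv_lhs => rw [g.as_sum]
  rw [map_sum, AddSubmonoidClass.coe_finsetSum, map_sum, coeffSum_apply, Finset.sum_filter]
  refine Finset.sum_congr rfl fun α _ => ?_
  have h : monomial α (coeff α g) = coeff α g • monomial α (1 : K) := by
    rw [smul_monomial, smul_eq_mul, mul_one]
  rw [h, map_smul, SetLike.val_smul, map_smul, coe_reesTheta_monomial S r hw,
    termCoeff_term_basisFn _ _ _ (weight_mem_weightMonoid hw α), smul_eq_mul, mul_ite, mul_one,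
    mul_zero]
  have hiff : (Finsupp.weight w α = u ∧ expVal S r w α = monoVal S r u)
      ↔ α ∈ {α | Finsupp.weight w α = u ∧ α ∈ exactExps S r w} := by
    refine and_congr_right ?_
    rintro rfl
    rfl
  by_cases h' : α ∈ {α | Finsupp.weight w α = u ∧ α ∈ exactExps S r w}
  · rw [if_pos (hiff.2 h'), if_pos h']
  · rw [if_neg fun h => h' (hiff.1 h), if_neg h']

variable [IsStrictTotalOrder (Face P) r]

/-- Superadditivity of `monoVal`, iterated over the factors of the monomial. -/
theorem expVal_le (hP : IsLatticePolytope P) (hdim : affineSpan ℝ P = ⊤)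
    (hw : ∀ i, w i ∈ weightMonoid P) (α : Fin p →₀ ℕ) :
    lexLE r (expVal S r w α) (monoVal S r (Finsupp.weight w α)) := by
  induction α using exponent_induction with
  | h0 => rw [map_zero, map_zero, monoVal_zero S r hP hdim]; exact Or.inl rfl
  | h1 i =>
    rw [expVal, Finsupp.weight_single, Finsupp.weight_single, one_smul, one_smul,
      quasiVal_basisFn S r hP (hw i)]
    exact Or.inl rfl
  | hadd α β hα hβ =>
    rw [map_add, map_add]
    exact (hα.add hβ).trans (monoVal_add_le S r hP hdim _ _)

theorem expVal_lt_of_notMem (hP : IsLatticePolytope P) (hdim : affineSpan ℝ P = ⊤)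
    (hw : ∀ i, w i ∈ weightMonoid P) {α : Fin p →₀ ℕ} (hα : α ∉ exactExps S r w) :
    lexLT r (expVal S r w α) (monoVal S r (Finsupp.weight w α)) :=
  (expVal_le S r hP hdim hw α).resolve_left hα

open Classical in
theorem thetaBar_monomial (hP : IsLatticePolytope P) (hdim : affineSpan ℝ P = ⊤)
    (hw : ∀ i, w i ∈ weightMonoid P) (α : Fin p →₀ ℕ) :
    thetaBar S r w (monomial α 1) = if α ∈ exactExps S r w then
      grClass S r (basisFn K P (Finsupp.weight w α)) else 0 := by
  have hα := weight_mem_weightMonoid hw α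
  rw [thetaBar_eq]
  split_ifs with h
  · rw [grClass]
    congr 1
    apply Subtype.ext
    change _ = GroupAlg.term (quasiVal S r (basisFn K P (Finsupp.weight w α))) _
    rw [coe_reesTheta_monomial S r hw, quasiVal_basisFn S r hP hα]
    exact congrArg (fun a => GroupAlg.term a _) h
  · refine Ideal.Quotient.eq_zero_iff_mem.2 (Ideal.subset_span ?_)
    refine ⟨_, _, basisFn_ne_zero hα, ?_, coe_reesTheta_monomial S r hw α⟩
    rw [quasiVal_basisFn S r hP hα]
    exact expVal_lt_of_notMem S r hP hdim hw h

theorem mem_ker_thetaBar_iff (hP : IsLatticePolytope P) (hdim : affineSpan ℝ P = ⊤)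
    (hw : ∀ i, w i ∈ weightMonoid P) (g : MvPolynomial (Fin p) K) :
    g ∈ RingHom.ker (thetaBar S r w) ↔
      ∀ u, coeffSum K {α | Finsupp.weight w α = u ∧ α ∈ exactExps S r w} g = 0 := by
  rw [RingHom.mem_ker]
  constructor
  · intro h u
    rw [thetaBar_eq, Ideal.Quotient.eq_zero_iff_mem] at h
    rw [← termCoeff_reesTheta S r hw]
    exact termCoeff_eq_zero_of_mem_reesIdeal S r hP hdim h u
  · intro h
    exact linearMap_eq_zero_of_coeffSum (thetaBar S r w).toLinearMap (Finsupp.weight w) _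
      (fun u => grClass S r (basisFn K P u)) (thetaBar_monomial S r hP hdim hw) h

/-- Write the class of f_u as θ̄(g) and compare coefficients of f_u in degree ν(f_u): the
coefficients of g at exact exponents over u sum to 1, so such an exponent occurs. -/
theorem exists_mem_exactExps (hP : IsLatticePolytope P) (hdim : affineSpan ℝ P = ⊤)
    (hw : ∀ i, w i ∈ weightMonoid P)
    (hgen : Algebra.adjoin K (Set.range fun i => grClass S r (basisFn K P (w i))) = ⊤)
    {u : HatM n} (hu : u ∈ weightMonoid P) : ∃ α ∈ exactExps S r w, Finsupp.weight w α = u := by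
  classical
  have h1 : grClass S r (basisFn K P u) ∈ (thetaBar S r w).range := by
    rw [thetaBar, ← Algebra.adjoin_range_eq_range_aeval, hgen]
    exact Algebra.mem_top
  obtain ⟨g, hg⟩ := h1
  have hg' : thetaBar S r w g = grClass S r (basisFn K P u) := hg
  rw [thetaBar_eq, grClass, Ideal.Quotient.eq] at hg'
  have h2 := termCoeff_eq_zero_of_mem_reesIdeal S r hP hdim hg' u
  rw [AddSubgroupClass.coe_sub, map_sub, termCoeff_reesTheta S r hw, sub_eq_zero] at h2
  change _ = termCoeff _ _ (GroupAlg.term (quasiVal S r (basisFn K P u)) _) at h2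
  rw [quasiVal_basisFn S r hP hu, termCoeff_term_basisFn _ _ _ hu, if_pos ⟨rfl, rfl⟩,
    coeffSum_apply] at h2
  obtain ⟨α, hα, -⟩ := Finset.exists_ne_zero_of_sum_ne_zero (h2 ▸ one_ne_zero)
  simp only [Finset.mem_filter, Set.mem_ofPred_eq] at hα
  obtain ⟨-, h3, h4⟩ := hα
  exact ⟨α, h4, h3⟩

end Kernels

/-! ### Limits under one-parameter subgroups -/

section Limits

variable {K : Type*} [Field K] {p : ℕ}

theorem gmAct_monomial (lam : Fin p → ℤ) (s : Kˣ) (α : Fin p →₀ ℕ) (k : K) :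
    gmAct lam s (monomial α k)
      = C ((s ^ (-Finsupp.weight lam α) : Kˣ) : K) * monomial α k := by
  have h : gmAct lam s (monomial α 1)
      = C ((s ^ (-Finsupp.weight lam α) : Kˣ) : K) * monomial α 1 := by
    induction α using exponent_induction with
    | h0 =>
      rw [map_zero, neg_zero, zpow_zero, Units.val_one, C_1, one_mul,
        show monomial 0 (1 : K) = 1 from rfl, map_one]
    | h1 i =>
      change gmAct lam s (X i) = _
      rw [gmAct, aeval_X, Finsupp.weight_single, one_smul]
      rfl
    | hadd α β hα hβ =>
      have h : monomial (α + β) (1 : K) = monomial α 1 * monomial β 1 := by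
        rw [monomial_mul, one_mul]
      rw [h, map_mul, hα, hβ, map_add, neg_add, zpow_add, Units.val_mul, C_mul]
      ring
  have hk : monomial α k = k • monomial α (1 : K) := by
    rw [smul_monomial, smul_eq_mul, mul_one]
  rw [hk, map_smul, h, mul_smul_comm]

/-- Two polynomial families agreeing at the infinitely many nonzero scalars 1, 2, 3, … coincide. -/
theorem IsLimitAtZero.unique [CharZero K] {φ : Kˣ → MvPolynomial (Fin p) K}
    {h h' : MvPolynomial (Fin p) K} (hh : IsLimitAtZero φ h) (hh' : IsLimitAtZero φ h') :
    h = h' := by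
  obtain ⟨F, hF, rfl⟩ := hh
  obtain ⟨G, hG, rfl⟩ := hh'
  have : F = G := by
    refine Polynomial.eq_of_infinite_eval_eq F G (Set.infinite_of_injective_forall_mem
      (f := fun k : ℕ => (C ((k + 1 : ℕ) : K) : MvPolynomial (Fin p) K)) ?_ fun k => ?_)
    · intro a b hab
      have := Nat.cast_injective (R := K) (C_injective _ _ hab)
      omega
    · let s : Kˣ := Units.mk0 ((k + 1 : ℕ) : K) (Nat.cast_ne_zero.2 k.succ_ne_zero)
      exact (hF s).trans (hG s).symm
  rw [this]

theorem isLimitAtZero_initialForm (lam : Fin p → ℤ) (g : MvPolynomial (Fin p) K) (d : ℤ)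
    (hd : IsGreatest ((fun α => Finsupp.weight lam α) '' (g.support : Set (Fin p →₀ ℕ))) d) :
    IsLimitAtZero (fun s => ((s ^ d : Kˣ) : K) • gmAct lam s g)
      (initialForm (fun α β => Finsupp.weight lam α < Finsupp.weight lam β) g) := by
  classical
  have hle : ∀ α ∈ g.support, Finsupp.weight lam α ≤ d := fun α hα => hd.2 ⟨α, hα, rfl⟩
  -- The term at α is scaled by s^{d - λ·α}. As d is the maximum, the exponent is nonnegative, and
  -- it is zero exactly on the initial form.
  refine ⟨∑ α ∈ g.support, Polynomial.C (monomial α (coeff α g))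
    * Polynomial.X ^ (d - Finsupp.weight lam α).toNat, fun s => ?_, ?_⟩
  · conv_rhs => rw [g.as_sum]
    change _ = ((s ^ d : Kˣ) : K) • gmAct lam s _
    rw [Polynomial.eval_finsetSum, map_sum, Finset.smul_sum]
    refine Finset.sum_congr rfl fun α hα => ?_
    have h1 : (s : K) ^ (d - Finsupp.weight lam α).toNat
        = ((s ^ d : Kˣ) : K) * ((s ^ (-Finsupp.weight lam α) : Kˣ) : K) := by
      rw [← Units.val_mul, ← zpow_add, ← Units.val_pow_eq_pow_val, ← zpow_natCast,
        Int.toNat_of_nonneg (sub_nonneg.2 (hle α hα)), sub_eq_add_neg]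
    rw [gmAct_monomial, Polynomial.eval_mul, Polynomial.eval_C, Polynomial.eval_pow,
      Polynomial.eval_X, ← C_pow, h1, C_mul, smul_eq_C_mul]
    ring
  · rw [Polynomial.eval_finsetSum, initialForm, Finset.sum_filter]
    refine Finset.sum_congr rfl fun α hα => ?_
    rw [Polynomial.eval_mul, Polynomial.eval_C, Polynomial.eval_pow, Polynomial.eval_X]
    obtain ⟨β, hβ, hβd⟩ := hd.1
    have hβd' : Finsupp.weight lam β = d := hβd
    split_ifs with h
    · have h1 : Finsupp.weight lam α = d :=
        (hle α hα).antisymm (hβd' ▸ not_lt.1 (h β hβ))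
      rw [h1, sub_self, Int.toNat_zero, pow_zero, mul_one]
    · push Not at h
      obtain ⟨γ, hγ, hlt⟩ := h
      have := hle γ hγ
      rw [zero_pow (by omega), mul_zero]

theorem limitIdeal_eq_inWeight [CharZero K] (lam : Fin p → ℤ)
    (I : Ideal (MvPolynomial (Fin p) K)) : limitIdeal lam I = inWeight lam I := by
  rw [limitIdeal, inWeight, initialIdeal]
  congr 1
  ext h
  constructor
  · rintro ⟨g, hg, hne, d, hd, hlim⟩
    exact ⟨g, hg, hne, hlim.unique (isLimitAtZero_initialForm lam g d hd)⟩
  · rintro ⟨g, hg, hne, rfl⟩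
    obtain ⟨α, hα, hmax⟩ := g.support.exists_max_image (fun α => Finsupp.weight lam α)
      (support_nonempty.2 hne)
    have hd : IsGreatest ((fun α => Finsupp.weight lam α) '' (g.support : Set (Fin p →₀ ℕ)))
        (Finsupp.weight lam α) := by
      refine ⟨⟨α, hα, rfl⟩, ?_⟩
      rintro _ ⟨β, hβ, rfl⟩
      exact hmax β hβ
    exact ⟨g, hg, hne, _, hd, isLimitAtZero_initialForm lam g _ hd⟩

end Limits

/-! ### The vanishing ideal of `X_P` -/

section VanishingIdeal

variable {K : Type*} [Field K] {n : ℕ} {P : Set (Fin n → ℝ)} {p : ℕ} {m : Fin p → ℕ}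
  {χ : Fin p → Fin n → ℤ}

theorem fst_weight (α : Fin p →₀ ℕ) :
    (Finsupp.weight (fun i => ((m i : ℤ), χ i)) α).1 = (Finsupp.weight m α : ℕ) := by
  induction α using exponent_induction with
  | h0 => simp
  | h1 i => simp [Finsupp.weight_single]
  | hadd α β hα hβ => simp [hα, hβ]

theorem exists_latticePoint (hP : IsLatticePolytope P) (hdim : affineSpan ℝ P = ⊤) :
    (latticePoints P).Nonempty := by
  obtain ⟨s, rfl⟩ := hP
  obtain ⟨x, hx⟩ := convexHull_nonempty_iff.1 (nonempty_of_affineSpan_eq_top hdim)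
  have hx' := subset_convexHull ℝ _ hx
  obtain ⟨χ, -, rfl⟩ := hx
  exact ⟨χ, hx'⟩

/-- The points with coordinates (m_i, χ_i)(c, t) lie on the variety, and a polynomial vanishing at
all of them is killed by θ. Conversely ker θ is spanned by binomials x^α - x^β with W(α) = W(β), and
these are weighted homogeneous because W records the degree. -/
theorem weightedI_weightedV_ker_theta [CharZero K] (hp : Nonempty (Fin p))
    (hw : ∀ i, ((m i : ℤ), χ i) ∈ weightMonoid P) :
    weightedI (weightedV m (RingHom.ker (theta K P fun i => ((m i : ℤ), χ i))))
      = RingHom.ker (theta K P fun i => ((m i : ℤ), χ i)) := by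
  apply le_antisymm
  · refine Ideal.span_le.2 ?_
    rintro f ⟨-, hf⟩
    rw [SetLike.mem_coe, RingHom.mem_ker]
    apply toGroup_injective
    rw [map_zero]
    refine eq_zero_of_groupEval_eq_zero fun c t => ?_
    rw [← eval_hatChar hw]
    have hv : (fun i => ((hatChar ((m i : ℤ), χ i) c t : Kˣ) : K)) ≠ 0 := fun h => by
      obtain ⟨i⟩ := hp
      exact Units.ne_zero _ (congrFun h i)
    refine hf (WeightedProj.mk m ⟨_, hv⟩) (fun g hg d _ => ?_) ⟨_, hv⟩ rfl
    intro v hv'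
    obtain ⟨ξ, hξ⟩ := Quotient.exact hv'.symm
    -- Changing the representative by ξ amounts to replacing c by ξc, since c enters coordinate i
    -- with exponent m_i.
    have e : v.1 = fun i => ((hatChar ((m i : ℤ), χ i) (ξ * c) t : Kˣ) : K) := by
      funext i
      rw [hξ i]
      simp only [hatChar, zpow_natCast, mul_pow, mul_assoc, Units.val_mul, Units.val_pow_eq_pow_val]
    rw [e, eval_hatChar hw, (RingHom.mem_ker).1 hg, map_zero, map_zero]
  · intro g hg
    refine mem_ideal_of_coeffSum (W := Finsupp.weight fun i => ((m i : ℤ), χ i)) (E := Set.univ)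
      (fun α hα => absurd (Set.mem_univ α) hα) (fun α β hW _ _ => Ideal.subset_span ?_)
      (by simpa using (mem_ker_theta_iff hw g).1 hg)
    have hdeg : Finsupp.weight m α = Finsupp.weight m β := by
      have := congrArg Prod.fst hW
      rw [fst_weight, fst_weight] at this
      exact_mod_cast this
    have hhom : IsWeightedHomogeneous m (monomial α (1 : K) - monomial β 1) (Finsupp.weight m α) :=
      (isWeightedHomogeneous_monomial m α 1 rfl).sub
        (isWeightedHomogeneous_monomial m β 1 hdeg.symm)
    refine ⟨⟨_, hhom⟩, fun x hx => hx _ ?_ _ hhom⟩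
    refine (mem_ker_theta_iff hw _).2 fun u => ?_
    rw [map_sub, coeffSum_monomial, coeffSum_monomial]
    simp only [Set.mem_ofPred_eq, hW]
    split_ifs <;> simp

end VanishingIdeal

/-! ### The orders given by the quasi-valuation and by an integral weight -/

section Orders

variable {K : Type*} [Field K] [CharZero K] {n : ℕ} {P : Set (Fin n → ℝ)} {p : ℕ}
  {m : Fin p → ℕ} {χ : Fin p → Fin n → ℤ}
  (S : CombSeshadriStratification K P) (r : Face P → Face P → Prop)
  [IsStrictTotalOrder (Face P) r]

/-- Each α_i is at most the degree ∑ m_j α_j, since all m_j are positive. -/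
theorem finite_fibre (hm : ∀ i, 1 ≤ m i) (u : HatM n) :
    {α : Fin p →₀ ℕ | Finsupp.weight (fun i => ((m i : ℤ), χ i)) α = u}.Finite := by
  refine (Set.finite_Iic (Finsupp.equivFunOnFinite.symm fun _ : Fin p => u.1.toNat)).subset ?_
  intro α hα i
  have h : (Finsupp.weight m α : ℤ) = u.1 := by
    rw [← fst_weight (χ := χ)]
    exact congrArg Prod.fst hα
  have h1 : α i ≤ Finsupp.weight m α := Finsupp.le_weight m (by have := hm i; omega) α
  change α i ≤ u.1.toNat
  omega

theorem inNu_ker_theta (hP : IsLatticePolytope P) (hdim : affineSpan ℝ P = ⊤)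
    {w : Fin p → HatM n} (hw : ∀ i, w i ∈ weightMonoid P)
    (hgen : Algebra.adjoin K (Set.range fun i => grClass S r (basisFn K P (w i))) = ⊤) :
    inNu S r w (RingHom.ker (theta K P w)) = RingHom.ker (thetaBar S r w) := by
  have hfst : ∀ α β : Fin p →₀ ℕ, Finsupp.weight w α = Finsupp.weight w β →
      Finsupp.weight (fun i => (w i).1) α = Finsupp.weight (fun i => (w i).1) β := by
    have h1 : ∀ α : Fin p →₀ ℕ,
        Finsupp.weight (fun i => (w i).1) α = (Finsupp.weight w α).1 := by
      intro α
      induction α using exponent_induction with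
      | h0 => simp
      | h1 i => simp [Finsupp.weight_single]
      | hadd α β hα hβ => simp [hα, hβ]
    intro α β h
    rw [h1, h1, h]
  refine initialIdeal_eq (W := Finsupp.weight w) (E := exactExps S r w) (mem_ker_theta_iff hw)
    (mem_ker_thetaBar_iff S r hP hdim hw)
    (fun α => exists_mem_exactExps S r hP hdim hw hgen (weight_mem_weightMonoid hw α)) ?_ ?_ ?_
  · rintro α β (h1 | ⟨h1, h2⟩) (h3 | ⟨h3, h4⟩)
    · exact lt_asymm h1 h3
    · exact h1.ne h3.symm
    · exact h3.ne h1.symm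
    · exact asymm_of (lexLT r) h2 h4
  · intro α β hW hα hβ
    refine Or.inr ⟨hfst α β hW, ?_⟩
    have h := expVal_lt_of_notMem S r hP hdim hw hβ
    rw [← hW, ← (show expVal S r w α = _ from hα)] at h
    exact h
  · intro α β γ hW hα hβ
    have hν : expVal S r w α = expVal S r w β := by
      rw [show expVal S r w α = _ from hα, show expVal S r w β = _ from hβ, hW]
    have hν' : Finsupp.weight (fun i => quasiVal S r (basisFn K P (w i))) α
        = Finsupp.weight (fun i => quasiVal S r (basisFn K P (w i))) β := hν
    rw [nuLT, nuLT, hfst α β hW, hν']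

theorem exists_inWeight_ker_theta (hP : IsLatticePolytope P) (hdim : affineSpan ℝ P = ⊤)
    (hm : ∀ i, 1 ≤ m i) (hw : ∀ i, ((m i : ℤ), χ i) ∈ weightMonoid P)
    (hgen : Algebra.adjoin K
      (Set.range fun i => grClass S r (basisFn K P ((m i : ℤ), χ i))) = ⊤) :
    ∃ lam : Fin p → ℤ, inWeight lam (RingHom.ker (theta K P fun i => ((m i : ℤ), χ i)))
      = RingHom.ker (thetaBar S r fun i => ((m i : ℤ), χ i)) := by
  set w : Fin p → HatM n := fun i => ((m i : ℤ), χ i) with hwdef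
  have hE : ∀ α, ∃ β ∈ exactExps S r w, Finsupp.weight w β = Finsupp.weight w α := fun α =>
    exists_mem_exactExps S r hP hdim hw hgen (weight_mem_weightMonoid hw α)
  have hνE : ∀ α ∈ exactExps S r w, ∀ β ∈ exactExps S r w,
      Finsupp.weight w α = Finsupp.weight w β → expVal S r w α = expVal S r w β := by
    intro α hα β hβ hW
    rw [show expVal S r w α = _ from hα, show expVal S r w β = _ from hβ, hW]
  have hlex : ∀ α β, Finsupp.weight w α = Finsupp.weight w β → α ∉ exactExps S r w →
      β ∈ exactExps S r w → lexLT r (expVal S r w α) (expVal S r w β) := by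
    intro α β hW hα hβ
    have h := expVal_lt_of_notMem S r hP hdim hw hα
    rwa [hW, ← (show expVal S r w β = _ from hβ)] at h
  obtain ⟨L, hL⟩ := exists_linear_separating (Finsupp.weight w) (expVal S r w) (exactExps S r w)
    hE hνE (fun α => finite_fibre hm _) (fun V hV h => by
      obtain ⟨L, hL⟩ := exists_linear_pos_of_lexLT (r := r)
        (hV.image fun v => expVal S r w v.2 - expVal S r w v.1) (by
          rintro _ ⟨v, hv, rfl⟩
          obtain ⟨h1, h2, h3⟩ := h v hv
          have h4 := hlex _ _ h1 h2 h3
          rwa [← lexLT_add_right_iff (-expVal S r w v.1), add_neg_cancel, ← sub_eq_add_neg] at h4)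
      refine ⟨L, fun v hv => ?_⟩
      have := hL _ ⟨v, hv, rfl⟩
      rwa [map_sub, sub_pos] at this)
  -- Take λ_i = -D · L(ν(f_i)): D clears denominators, and the sign is reversed because a larger
  -- value of ν means a lower monomial.
  obtain ⟨D, hD, z, hz⟩ := exists_nat_mul_eq_intCast
    fun i => L (quasiVal S r (basisFn K P (w i)))
  have hlam : ∀ α : Fin p →₀ ℕ,
      ((Finsupp.weight (fun i => -z i) α : ℤ) : ℚ) = -(D * L (expVal S r w α)) := by
    intro α
    induction α using exponent_induction with
    | h0 => simp
    | h1 i => simp [expVal, Finsupp.weight_single, hz]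
    | hadd α β hα hβ =>
      rw [map_add, map_add, map_add, Int.cast_add, hα, hβ]
      ring
  have hD' : (0 : ℚ) < D := Nat.cast_pos.2 hD
  refine ⟨fun i => -z i, initialIdeal_eq (W := Finsupp.weight w) (mem_ker_theta_iff hw)
    (mem_ker_thetaBar_iff S r hP hdim hw) hE (fun α β => lt_asymm) ?_ ?_⟩
  · intro α β hW hα hβ
    have h := mul_lt_mul_of_pos_left (hL β α hW.symm hβ hα) hD'
    have h' : ((Finsupp.weight (fun i => -z i) α : ℤ) : ℚ)
        < ((Finsupp.weight (fun i => -z i) β : ℤ) : ℚ) := by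
      rw [hlam, hlam]
      linarith
    exact_mod_cast h'
  · intro α β γ hW hα hβ
    have h : ((Finsupp.weight (fun i => -z i) α : ℤ) : ℚ)
        = ((Finsupp.weight (fun i => -z i) β : ℤ) : ℚ) := by
      rw [hlam, hlam, hνE α hα β hβ hW]
    rw [Int.cast_injective h]

end Orders

end

end ToricDegeneration

/-! ### The degeneration theorem -/

theorem mainTheorem9 {K : Type*} [Field K] [IsAlgClosed K] [CharZero K] {n : ℕ}
    (P : Set (Fin n → ℝ)) (hP : IsLatticePolytope P) (hdim : affineSpan ℝ P = ⊤)
    (hnormal : IsNormalPolytope P)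
    (S : CombSeshadriStratification K P)
    (r : Face P → Face P → Prop) [IsStrictTotalOrder (Face P) r]
    (hr : ∀ σ τ : Face P, σ < τ → r σ τ)
    {p : ℕ} (m : Fin p → ℕ) (χ : Fin p → Fin n → ℤ)
    (hm : ∀ i, 1 ≤ m i)
    (hw : ∀ i, ((m i : ℤ), χ i) ∈ weightMonoid P)
    (hG₁ : ∀ η ∈ latticePoints P, ∃ i, m i = 1 ∧ χ i = η)
    (hgen : Algebra.adjoin K
      (Set.range fun i => grClass S r (basisFn K P ((m i : ℤ), χ i))) = ⊤) :
    let w : Fin p → HatM n := fun i => ((m i : ℤ), χ i)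
    let J : Ideal (MvPolynomial (Fin p) K) := RingHom.ker (theta K P w)
    let J₀ : Ideal (MvPolynomial (Fin p) K) := RingHom.ker (thetaBar S r w)
    let XP : Set (WeightedProj K m) := weightedV m J
    let X₀ : Set (WeightedProj K m) := weightedV m J₀
    inNu S r w J = J₀ ∧
    (∃ lam : Fin p → ℤ, inWeight lam J = inNu S r w J) ∧
    ∀ lam : Fin p → ℤ, inWeight lam J = inNu S r w J →
      limitIdeal lam J = J₀ ∧ IsToricDegeneration lam XP X₀ := by
  intro w J J₀ XP X₀
  have hν : inNu S r w J = J₀ := inNu_ker_theta S r hP hdim hw hgen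
  refine ⟨hν, ?_, fun lam hlam => ⟨?_, ?_⟩⟩
  · rw [hν]
    exact exists_inWeight_ker_theta S r hP hdim hm hw hgen
  · rw [limitIdeal_eq_inWeight, hlam, hν]
  -- A lattice point of P provides a variable, so p > 0 and the torus points are nonzero vectors.
  · obtain ⟨η, hη⟩ := exists_latticePoint hP hdim
    obtain ⟨i, -⟩ := hG₁ η hη
    have hI : weightedI XP = J := weightedI_weightedV_ker_theta ⟨i⟩ hw
    rw [IsToricDegeneration, hI, hlam, hν]
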